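/- Notation. For a Borel probability measure $\mu$ on $[0,1]$ let $\widehat\mu(\xi)=\int e^{-2\pi i x\xi}\,d\mu(x)$. For $M\in\mathbb N$ let $\mathcal Q_M=\big(\bigcup_{1\le N\le M}\tfrac1N\mathbb Z\big)\cap[-M,M]$. Let $\varphi,\psi$ be real-valued Schwartz functions on $\mathbb R$ such that $\widehat\psi$ is supported in an annulus away from the origin (that is, in a compact set not containing $0$) and $\widehat\varphi(\xi)+\sum_{l\ge1}\widehat\psi(\xi/2^l)=1$ for all $\xi\in\mathbb R$; put $\mu_{\le 0}=\varphi*\mu$ and $\mu_l=\psi_l*\mu$, where $\psi_l(x)=2^l\psi(2^lx)$. For $\Theta=(\theta_1,\theta_2)$ with $\theta_1\neq\theta_2$ and a bounded continuous $h$ put $$\Lambda_\Theta(h,\mu,\mu)=\int\!\!\int h\Big(\frac{\theta_2x-\theta_1t}{\theta_2-\theta_1}\Big)\,d\mu(x)\,d\mu(t),$$ and let $$\Lambda_\Theta(\mu)=\Lambda_\Theta(\mu_{\le0},\mu,\mu)+\sum_{l\ge1}\Lambda_\Theta(\mu_l,\mu,\mu),$$ which is the meaning given to the formal expression $\int\mu\big(\frac{\theta_2x-\theta_1t}{\theta_2-\theta_1}\big)\,d\mu(x)\,d\mu(t)$.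 Proposition. For every $M\in\mathbb N$ and $A\in\mathbb R$ there is a constant $c>0$, depending only on $M$ and $A$, such that the following holds. For all $c_0>0$, $B\in\mathbb R$ and $\omega:\mathbb N\to\mathbb R$ with $\omega(l)\to0$ as $l\to\infty$ there is $\varepsilon_0>0$ (depending only on $M,A,c_0,B,\omega$) such that, whenever $1-\varepsilon_0<s\le1$, $c_0>\frac{1-s}{4}$, and $\mu$ is a Borel probability measure on $[0,1]$ satisfying 1. (Frostman condition of dimension $s$) $\mu(I)\le A|I|^s$ for every compact interval $I$ of positive length, and 2. (quantitative Fourier uniformity) $\|\widehat\mu\cdot\mathbf 1_{2^{l-1}\le|\xi|\le2^{l+1}}\|_{L^4(\mathbb R)}\le B\,2^{(\omega(l)-c_0)l}$ for every integer $l\ge1$, then for all distinct nonzero $\theta_1,\theta_2\in\mathcal Q_M$ and all $\varphi,\psi$ as above the series defining $\Lambda_\Theta(\mu)$ converges absolutely and $$\Lambda_\Theta(\mu)\ge c.$$ -/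

import Mathlib

open scoped FourierTransform SchwartzMap

noncomputable section

namespace Roth

/-- `𝒬_M`: the rationals in `[-M, M]` with some denominator `N`, `1 ≤ N ≤ M`. -/
def ratQ (M : ℕ) : Set ℝ :=
  {θ | ∃ N : ℕ, 1 ≤ N ∧ N ≤ M ∧ ∃ a : ℤ, θ = (a : ℝ) / (N : ℝ)} ∩ Set.Icc (-(M : ℝ)) (M : ℝ)

/-- The Frostman condition with exponent `s` and constant `A`: `μ(I) ≤ A |I|^s` for every
compact interval `I` of positive length. -/
def IsFrostman (μ : MeasureTheory.Measure ℝ) (s A : ℝ) : Prop :=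
  ∀ a b : ℝ, a < b → μ (Set.Icc a b) ≤ ENNReal.ofReal (A * (b - a) ^ s)

/-- The Fourier transform of a measure, `μ̂(ξ) = ∫ e^{-2πi x ξ} dμ(x)`. -/
def fourierMeasure (μ : MeasureTheory.Measure ℝ) (ξ : ℝ) : ℂ :=
  ∫ x, Complex.exp (-(2 * Real.pi * x * ξ : ℝ) * Complex.I) ∂μ

/-- The dyadic shell `{ξ : 2^{l-1} ≤ |ξ| ≤ 2^{l+1}}`. -/
def shell (l : ℕ) : Set ℝ :=
  {ξ | (2 : ℝ) ^ ((l : ℝ) - 1) ≤ |ξ| ∧ |ξ| ≤ (2 : ℝ) ^ ((l : ℝ) + 1)}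

/-- Quantitative Fourier uniformity with exponent `c₀`, constant `B` and a function `ω` in the role
of the `o(1)` term: `‖μ̂ · 1_{2^{l-1} ≤ |ξ| ≤ 2^{l+1}}‖_{L⁴} ≤ B 2^{(ω(l) - c₀) l}`, `l ≥ 1`. -/
def IsFourierUniform (μ : MeasureTheory.Measure ℝ) (c₀ B : ℝ) (ω : ℕ → ℝ) : Prop :=
  ∀ l : ℕ, 1 ≤ l →
    MeasureTheory.eLpNorm ((shell l).indicator (fourierMeasure μ)) 4 MeasureTheory.volume
      ≤ ENNReal.ofReal (B * (2 : ℝ) ^ ((ω l - c₀) * (l : ℝ)))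

/-- The Fourier transform of a real-valued Schwartz function,
`f̂(ξ) = ∫ e^{-2πi x ξ} f(x) dx`. -/
def schwartzHat (f : 𝓢(ℝ, ℝ)) : ℝ → ℂ :=
  𝓕 (fun x : ℝ => ((f x : ℝ) : ℂ))

/-- A (Littlewood-Paley) partition of unity in Fourier space: `ψ̂` is supported in an annulus
away from the origin and `φ̂(ξ) + ∑_{l ≥ 1} ψ̂(ξ / 2^l) = 1` for every `ξ`. -/
structure IsLittlewoodPaley (φ ψ : 𝓢(ℝ, ℝ)) : Prop where
  hasCompactSupport : HasCompactSupport (schwartzHat ψ)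
  zero_notMem : (0 : ℝ) ∉ tsupport (schwartzHat ψ)
  hasSum : ∀ ξ : ℝ,
    HasSum (fun l : ℕ => schwartzHat ψ (ξ / 2 ^ (l + 1))) (1 - schwartzHat φ ξ)

/-- `f_l * μ`, where `f_l(x) = 2^l f(2^l x)`. -/
def conv (f : 𝓢(ℝ, ℝ)) (l : ℕ) (μ : MeasureTheory.Measure ℝ) (y : ℝ) : ℝ :=
  ∫ z, (2 : ℝ) ^ l * f (2 ^ l * (y - z)) ∂μ

/-- `Λ_Θ(h, μ, μ) = ∫ h((θ₂ x - θ₁ t) / (θ₂ - θ₁)) dμ(x) dμ(t)` for a function `h`. -/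
def formAt (θ₁ θ₂ : ℝ) (h : ℝ → ℝ) (μ : MeasureTheory.Measure ℝ) : ℝ :=
  ∫ t, ∫ x, h ((θ₂ * x - θ₁ * t) / (θ₂ - θ₁)) ∂μ ∂μ

/-- `Λ_Θ(μ) = Λ_Θ(φ * μ, μ, μ) + ∑_{l ≥ 1} Λ_Θ(ψ_l * μ, μ, μ)`, the meaning of the formal
expression `∫ μ((θ₂ x - θ₁ t) / (θ₂ - θ₁)) dμ(x) dμ(t)`. -/
def form (φ ψ : 𝓢(ℝ, ℝ)) (θ₁ θ₂ : ℝ) (μ : MeasureTheory.Measure ℝ) : ℝ :=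
  formAt θ₁ θ₂ (conv φ 0 μ) μ + ∑' l : ℕ, formAt θ₁ θ₂ (conv ψ (l + 1) μ) μ

end Roth

end

noncomputable section

namespace Roth

open MeasureTheory

/-! Put `a = θ₂/(θ₂ - θ₁)` and `b = θ₁/(θ₂ - θ₁)`, so that `a - b = 1` and `a θ₁ = b θ₂`. By Fourier
inversion and the partition of unity, Λ_Θ(μ) equals the integral T of μ̂(ξ) μ̂(-aξ) μ̂(bξ) over all
frequencies, once this integral converges absolutely (`summable_and_form_eq`). The proof compares T
with its version mollified at scale 1/r, where `g` is a nonnegative bump and ĝ(ξ/r) is inserted in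
the integrand.

High frequencies (`exists_tail_le`): with κ = c₀/2, Fourier uniformity puts |ξ|^κ μ̂ in L⁴ and the
Frostman condition with 1 - s ≤ κ puts |ξ|^(-κ) μ̂ in L². Hölder exponents 4, 4, 2 then leave a
spare factor |ξ|^(-κ), so the tail beyond R is O(R^(-κ)). Low frequencies: ĝ(ξ/r) is close to ĝ(0) =
∫ g for |ξ| ≤ R when r is large. Hence (∫ g) T is within c/2 of the mollified form.

Main term (`exists_neighbourhood_ge`): the mollified form dominates r times the μ³-mass of a
1/r-neighbourhood of the plane z = ax - bt. If r^(1-s) ≤ 2, then μ has density bounded at scale 1/r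
by a constant depending only on A, so it is spread over a set E of measure bounded below. The
corners theorem, applied to grids y + r'(θ₁i + θ₂j), gives many triples z, z + ρθ₁, z + ρθ₂ in E
(`exists_lintegral_cornerDensity_ge`), and these lie on the plane. The resulting c depends only on M
and A. The parameters R, r and finally ε₀ are chosen after c, which is how s close to 1 enters
without affecting c. -/

/-! ### Fourier transforms of measures and of Schwartz functions -/

/-- The additive character `y ↦ e^{2πiy}`. -/
def unitChar (y : ℝ) : ℂ := Complex.exp ((2 * Real.pi * y : ℝ) * Complex.I)

lemma norm_unitChar (y : ℝ) : ‖unitChar y‖ = 1 := Complex.norm_exp_ofReal_mul_I _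

lemma unitChar_add (x y : ℝ) : unitChar (x + y) = unitChar x * unitChar y := by
  rw [unitChar, unitChar, unitChar, ← Complex.exp_add]; congr 1; push_cast; ring

@[fun_prop]
lemma continuous_unitChar : Continuous unitChar := by unfold unitChar; fun_prop

lemma unitChar_zero : unitChar 0 = 1 := by simp [unitChar]

lemma star_unitChar (y : ℝ) : (starRingEnd ℂ) (unitChar y) = unitChar (-y) := by
  rw [unitChar, unitChar, ← Complex.exp_conj]; congr 1
  rw [map_mul, Complex.conj_ofReal, Complex.conj_I]; push_cast; ring

lemma fourierMeasure_eq (μ : Measure ℝ) (ξ : ℝ) :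
    fourierMeasure μ ξ = ∫ x, unitChar (-(x * ξ)) ∂μ := by
  unfold fourierMeasure unitChar; congr 1; ext x; congr 2; push_cast; ring

lemma norm_fourierMeasure_le (μ : Measure ℝ) [IsProbabilityMeasure μ] (ξ : ℝ) :
    ‖fourierMeasure μ ξ‖ ≤ 1 := by
  rw [fourierMeasure_eq]
  refine (norm_integral_le_of_norm_le_const (C := 1) (by simp [norm_unitChar])).trans ?_
  simp

@[fun_prop]
lemma continuous_fourierMeasure (μ : Measure ℝ) [IsProbabilityMeasure μ] :
    Continuous (fourierMeasure μ) := by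
  have : fourierMeasure μ = fun ξ => ∫ x, unitChar (-(x * ξ)) ∂μ := by
    ext; exact fourierMeasure_eq _ _
  rw [this]
  refine continuous_of_dominated (bound := fun _ => 1) ?_ ?_ (integrable_const _) ?_
  · intro x; exact Continuous.aestronglyMeasurable (by fun_prop)
  · intro x; simp [norm_unitChar]
  · refine Filter.Eventually.of_forall fun x => by fun_prop

lemma fourierMeasure_neg (μ : Measure ℝ) (ξ : ℝ) :
    fourierMeasure μ (-ξ) = (starRingEnd ℂ) (fourierMeasure μ ξ) := by
  rw [fourierMeasure_eq, fourierMeasure_eq, ← integral_conj]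
  simp [star_unitChar]

lemma norm_fourierMeasure_neg (μ : Measure ℝ) (ξ : ℝ) :
    ‖fourierMeasure μ (-ξ)‖ = ‖fourierMeasure μ ξ‖ := by
  rw [fourierMeasure_neg, RCLike.norm_conj]

/-- The complexification of a real-valued Schwartz function. -/
def complexify (g : 𝓢(ℝ, ℝ)) : 𝓢(ℝ, ℂ) := g.postcompCLM Complex.ofRealCLM

lemma schwartzHat_eq (g : 𝓢(ℝ, ℝ)) : schwartzHat g = ⇑(𝓕 (complexify g) : 𝓢(ℝ, ℂ)) := rfl

lemma integrable_schwartzHat (g : 𝓢(ℝ, ℝ)) : Integrable (schwartzHat g) := by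
  rw [schwartzHat_eq]; exact SchwartzMap.integrable _

@[fun_prop]
lemma continuous_schwartzHat (g : 𝓢(ℝ, ℝ)) : Continuous (schwartzHat g) := by
  rw [schwartzHat_eq]; exact SchwartzMap.continuous _

lemma exists_norm_schwartzHat_le (g : 𝓢(ℝ, ℝ)) : ∃ C, 0 < C ∧ ∀ ξ, ‖schwartzHat g ξ‖ ≤ C := by
  obtain ⟨C, hC, h⟩ := (𝓕 (complexify g) : 𝓢(ℝ, ℂ)).decay 0 0
  exact ⟨C, hC, fun ξ => by simpa [schwartzHat_eq] using h ξ⟩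

lemma schwartzHat_apply (g : 𝓢(ℝ, ℝ)) (ξ : ℝ) :
    schwartzHat g ξ = ∫ x, unitChar (-(x * ξ)) * (g x : ℂ) := by
  rw [schwartzHat, Real.fourier_eq']
  congr 1; ext x
  simp [unitChar, mul_comm, mul_left_comm]

lemma schwartzHat_inversion (g : 𝓢(ℝ, ℝ)) (y : ℝ) :
    (g y : ℂ) = ∫ ξ, schwartzHat g ξ * unitChar (y * ξ) := by
  have h := congrFun (Continuous.fourierInv_fourier_eq (f := fun x : ℝ => ((g x : ℝ) : ℂ))
    (complexify g).continuous (complexify g).integrable (integrable_schwartzHat g)) y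
  rw [← h, Real.fourierInv_eq']
  congr 1; ext x
  simp [unitChar, mul_comm, mul_left_comm, schwartzHat]

lemma dilate_inversion (g : 𝓢(ℝ, ℝ)) {r : ℝ} (hr : 0 < r) (y : ℝ) :
    ((r * g (r * y) : ℝ) : ℂ) = ∫ ξ, schwartzHat g (ξ / r) * unitChar (y * ξ) := by
  have h := Measure.integral_comp_div (fun η => schwartzHat g η * unitChar (r * y * η)) r
  rw [← schwartzHat_inversion, abs_of_pos hr] at h
  push_cast
  rw [← Complex.real_smul, ← h]
  congr 1; ext ξ; congr 2; field_simp

lemma schwartz_bounded (g : 𝓢(ℝ, ℝ)) : ∃ C, ∀ x, |g x| ≤ C := by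
  obtain ⟨C, -, h⟩ := g.decay 0 0
  exact ⟨C, fun x => by simpa using h x⟩

lemma integrable_of_bounded_continuous {α : Type*} [TopologicalSpace α] [MeasurableSpace α]
    [OpensMeasurableSpace α] {P : Measure α}
    [IsFiniteMeasure P] {f : α → ℝ} (hf : Continuous f) {C : ℝ} (hC : ∀ x, |f x| ≤ C) :
    Integrable f P :=
  Integrable.of_bound hf.measurable.aestronglyMeasurable C (Filter.Eventually.of_forall hC)

/-! ### Smoothed trilinear forms in physical and frequency space -/

lemma integral_trilinear_eq_prod {G : ℝ → ℝ} (hG : Continuous G) {C : ℝ} (hC : ∀ y, |G y| ≤ C)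
    (a b : ℝ) (μ₁ μ₂ μ₃ : Measure ℝ) [IsProbabilityMeasure μ₁] [IsProbabilityMeasure μ₂]
    [IsProbabilityMeasure μ₃] :
    ∫ t, ∫ x, ∫ z, G (a * x - b * t - z) ∂μ₃ ∂μ₁ ∂μ₂ =
      ∫ p : ℝ × ℝ × ℝ, G (a * p.2.1 - b * p.1 - p.2.2) ∂(μ₂.prod (μ₁.prod μ₃)) := by
  rw [integral_prod]
  · congr 1; ext t
    rw [integral_prod]
    exact integrable_of_bounded_continuous (by fun_prop) (fun p => hC _)
  · exact integrable_of_bounded_continuous (by fun_prop) (fun p => hC _)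

/-- The Fourier side of a trilinear form. -/
lemma trilinear_eq (g : 𝓢(ℝ, ℝ)) {r : ℝ} (hr : 0 < r) (a b : ℝ) (μ₁ μ₂ μ₃ : Measure ℝ)
    [IsProbabilityMeasure μ₁] [IsProbabilityMeasure μ₂] [IsProbabilityMeasure μ₃] :
    ((∫ t, ∫ x, ∫ z, r * g (r * (a * x - b * t - z)) ∂μ₃ ∂μ₁ ∂μ₂ : ℝ) : ℂ) =
      ∫ ξ, schwartzHat g (ξ / r) *
        (fourierMeasure μ₃ ξ * (fourierMeasure μ₁ (-(a * ξ)) * fourierMeasure μ₂ (b * ξ))) := by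
  obtain ⟨C, hC⟩ := schwartz_bounded g
  have hbd : ∀ y, |r * g y| ≤ r * C := fun y => by
    rw [abs_mul, abs_of_pos hr]; exact mul_le_mul_of_nonneg_left (hC y) hr.le
  have hg := g.continuous
  have h1 : ∫ t, ∫ x, ∫ z, r * g (r * (a * x - b * t - z)) ∂μ₃ ∂μ₁ ∂μ₂
      = ∫ p : ℝ × ℝ × ℝ, r * g (r * (a * p.2.1 - b * p.1 - p.2.2)) ∂(μ₂.prod (μ₁.prod μ₃)) :=
    integral_trilinear_eq_prod (G := fun y => r * g (r * y)) (by fun_prop) (fun y => hbd _) a b μ₁ μ₂ μ₃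
  have hH : Integrable (fun ξ => schwartzHat g (ξ / r)) :=
    (integrable_schwartzHat g).comp_div hr.ne'
  rw [h1, ← integral_complex_ofReal]
  simp_rw [dilate_inversion g hr]
  rw [integral_integral_swap]
  · congr 1; ext ξ
    rw [integral_const_mul]
    congr 1
    -- The character separates the three variables, so the space integral becomes a product of three
    -- Fourier transforms.
    have : ∀ p : ℝ × ℝ × ℝ, unitChar ((a * p.2.1 - b * p.1 - p.2.2) * ξ) =
        unitChar (-(p.1 * (b * ξ))) *
          (unitChar (-(p.2.1 * (-(a * ξ)))) * unitChar (-(p.2.2 * ξ))) := by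
      intro p; rw [← unitChar_add, ← unitChar_add]; congr 1; ring
    simp_rw [this]
    rw [integral_prod_mul (fun t => unitChar (-(t * (b * ξ))))
      (fun p : ℝ × ℝ => unitChar (-(p.1 * (-(a * ξ)))) * unitChar (-(p.2 * ξ))),
      integral_prod_mul (fun t => unitChar (-(t * (-(a * ξ)))))
      (fun t => unitChar (-(t * ξ)))]
    simp_rw [fourierMeasure_eq]
    ring
  · have h2 : Integrable (fun q : (ℝ × ℝ × ℝ) × ℝ => (1 : ℂ) * schwartzHat g (q.2 / r))
      ((μ₂.prod (μ₁.prod μ₃)).prod volume) := Integrable.mul_prod (integrable_const 1) hH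
    refine h2.mono (Continuous.aestronglyMeasurable ?_) (Filter.Eventually.of_forall fun q => ?_)
    · have := continuous_schwartzHat g
      simp only [Function.uncurry_def]
      fun_prop
    · simp [Function.uncurry, norm_unitChar]

/-! ### Bump functions and the L² bound for Frostman measures -/

lemma exists_bump {C : ℝ} (hC : 0 < C) : ∃ g : 𝓢(ℝ, ℝ), (∀ x, 0 ≤ g x) ∧ (∀ x, g x ≤ 1) ∧
    (∀ x, |x| ≤ C → g x = 1) ∧ (∀ x, 2 * C ≤ |x| → g x = 0) ∧ 0 < ∫ x, g x := by
  let f : ContDiffBump (0 : ℝ) := ⟨C, 2 * C, hC, by linarith⟩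
  refine ⟨f.hasCompactSupport.toSchwartzMap f.contDiff, fun x => f.nonneg, fun x => f.le_one,
    fun x hx => f.one_of_mem_closedBall (by simpa [f] using hx),
    fun x hx => f.zero_of_le_dist (by simpa [f] using hx), f.integral_pos⟩

lemma schwartzHat_zero (g : 𝓢(ℝ, ℝ)) : schwartzHat g 0 = ((∫ x, g x : ℝ) : ℂ) := by
  rw [schwartzHat_apply, ← integral_complex_ofReal]; simp [unitChar_zero]

lemma norm_schwartzHat_le_integral (g : 𝓢(ℝ, ℝ)) (h0 : ∀ x, 0 ≤ g x) (ξ : ℝ) :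
    ‖schwartzHat g ξ‖ ≤ ∫ x, g x := by
  rw [schwartzHat_apply]
  refine (norm_integral_le_integral_norm _).trans_eq ?_
  congr 1; ext x
  simp [norm_unitChar, abs_of_nonneg (h0 x)]

lemma IsFrostman.real_le {μ : Measure ℝ} {s A : ℝ} (h : IsFrostman μ s A) {a b : ℝ} (hab : a < b) :
    μ.real (Set.Icc a b) ≤ max A 0 * (b - a) ^ s := by
  have hp : 0 ≤ (b - a) ^ s := Real.rpow_nonneg (by linarith) _
  refine ENNReal.toReal_le_of_le_ofReal (by positivity) ((h a b hab).trans ?_)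
  exact ENNReal.ofReal_le_ofReal (mul_le_mul_of_nonneg_right (le_max_left _ _) hp)

/-- Mollifications of a Frostman measure are bounded. -/
lemma mollify_le {μ : Measure ℝ} [IsProbabilityMeasure μ] {s A : ℝ} (h : IsFrostman μ s A)
    {g : 𝓢(ℝ, ℝ)} (hg1 : ∀ x, g x ≤ 1) (hg2 : ∀ x, 2 ≤ |x| → g x = 0)
    {r : ℝ} (hr : 0 < r) (y : ℝ) :
    ∫ z, r * g (r * (y - z)) ∂μ ≤ r * (max A 0 * (4 / r) ^ s) := by
  have hm := h.real_le (a := y - 2 / r) (b := y + 2 / r) (by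
    have : 0 < 2 / r := by positivity
    linarith)
  have he : y + 2 / r - (y - 2 / r) = 4 / r := by ring
  rw [he] at hm
  rw [integral_const_mul]
  refine mul_le_mul_of_nonneg_left (le_trans ?_ hm) hr.le
  rw [← integral_indicator_one measurableSet_Icc]
  obtain ⟨C, hC⟩ := schwartz_bounded g
  have hgc := g.continuous
  refine integral_mono (integrable_of_bounded_continuous (by fun_prop) (fun z => hC _))
    ((integrable_const (1 : ℝ)).indicator measurableSet_Icc) fun z => ?_
  by_cases hz : z ∈ Set.Icc (y - 2 / r) (y + 2 / r)
  · simp only [Set.indicator_of_mem hz]; exact hg1 _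
  · simp only [Set.indicator_of_notMem hz]
    refine (hg2 _ ?_).le
    rw [abs_mul, abs_of_pos hr, ← div_le_iff₀' hr]
    by_contra hlt
    push Not at hlt
    rw [abs_lt] at hlt
    exact hz ⟨by linarith, by linarith⟩

/-- The probability measure with density proportional to `g`. -/
def densityMeasure (g : 𝓢(ℝ, ℝ)) : Measure ℝ :=
  volume.withDensity fun x => ENNReal.ofReal (g x / ∫ y, g y)

lemma isProbabilityMeasure_densityMeasure {g : 𝓢(ℝ, ℝ)} (hg0 : ∀ x, 0 ≤ g x)
    (hI : 0 < ∫ x, g x) : IsProbabilityMeasure (densityMeasure g) := by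
  constructor
  rw [densityMeasure, withDensity_apply _ MeasurableSet.univ, Measure.restrict_univ,
    ← ofReal_integral_eq_lintegral_ofReal (g.integrable.div_const _)
      (Filter.Eventually.of_forall fun x => div_nonneg (hg0 x) hI.le), integral_div,
    div_self hI.ne', ENNReal.ofReal_one]

lemma fourierMeasure_densityMeasure {g : 𝓢(ℝ, ℝ)} (hg0 : ∀ x, 0 ≤ g x)
    (hI : 0 < ∫ x, g x) (ξ : ℝ) :
    fourierMeasure (densityMeasure g) ξ = schwartzHat g ξ / ((∫ x, g x : ℝ) : ℂ) := by
  have hgc := g.continuous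
  rw [fourierMeasure_eq, densityMeasure,
    integral_withDensity_eq_integral_toReal_smul (by fun_prop) (by simp), schwartzHat_apply,
    ← integral_div]
  congr 1; ext x
  rw [ENNReal.toReal_ofReal (div_nonneg (hg0 x) hI.le), Complex.real_smul]
  push_cast
  ring

lemma exists_half_le_norm_schwartzHat (g : 𝓢(ℝ, ℝ)) (hI : 0 < ∫ x, g x) :
    ∃ η : ℝ, 0 < η ∧ η ≤ 1 ∧ ∀ ξ, |ξ| ≤ η → (∫ x, g x) / 2 ≤ ‖schwartzHat g ξ‖ := by
  have hc : Continuous fun ξ => ‖schwartzHat g ξ‖ := (continuous_schwartzHat g).norm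
  have h0 : (∫ x, g x) / 2 < ‖schwartzHat g 0‖ := by
    rw [schwartzHat_zero, Complex.norm_real, Real.norm_of_nonneg hI.le]; linarith
  obtain ⟨η, hη, h⟩ := Metric.eventually_nhds_iff.1 (hc.continuousAt.eventually (lt_mem_nhds h0))
  refine ⟨min (η / 2) 1, by positivity, min_le_right _ _, fun ξ hξ => (h ?_).le⟩
  rw [Real.dist_eq, sub_zero]
  exact (hξ.trans (min_le_left _ _)).trans_lt (by linarith)

/-- The `L²` mass of the Fourier transform of a Frostman measure on `[-R, R]`. -/
lemma IsFrostman.lintegral_sq_le (A : ℝ) : ∃ C : ℝ, 0 < C ∧ ∀ (s : ℝ) (μ : Measure ℝ),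
    0 < s → s ≤ 1 → IsProbabilityMeasure μ → IsFrostman μ s A → ∀ R : ℝ, 1 ≤ R →
      ∫⁻ ξ in {ξ : ℝ | |ξ| ≤ R}, ENNReal.ofReal (‖fourierMeasure μ ξ‖ ^ 2)
        ≤ ENNReal.ofReal (C * R ^ (1 - s)) := by
  obtain ⟨g, hg0, hg1, -, hg2, hI⟩ := exists_bump one_pos
  rw [mul_one] at hg2
  obtain ⟨η, hη, hη1, hlow⟩ := exists_half_le_norm_schwartzHat g hI
  set I := ∫ x, g x with hIdef
  -- The factor 4/I comes from |ĝ| ≥ I/2 near 0, the second 4 from 4^s ≤ 4, and 1/η from working at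
  -- scale r = R/η.
  refine ⟨4 / I * (4 * (max A 0 + 1) / η), by positivity, fun s μ hs hs1 hμ hF R hR => ?_⟩
  have hr : 0 < R / η := by positivity
  set r := R / η with hrdef
  have hγ := isProbabilityMeasure_densityMeasure hg0 hI
  have hmeas : Measurable fun p : ℝ × ℝ => p.1 + p.2 / r := by fun_prop
  -- ν is μ convolved with the normalised bump at scale 1/r, so ν̂(ξ) = μ̂(ξ) ĝ(ξ/r)/I.
  set ν : Measure ℝ := (μ.prod (densityMeasure g)).map (fun p => p.1 + p.2 / r) with hν
  have hνp : IsProbabilityMeasure ν := Measure.isProbabilityMeasure_map hmeas.aemeasurable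
  have hνhat : ∀ ξ, fourierMeasure ν ξ = fourierMeasure μ ξ * (schwartzHat g (ξ / r) / (I : ℂ)) := by
    intro ξ
    rw [← fourierMeasure_densityMeasure hg0 hI, fourierMeasure_eq, hν,
      integral_map hmeas.aemeasurable (Continuous.aestronglyMeasurable (by fun_prop)),
      fourierMeasure_eq, fourierMeasure_eq, ← integral_prod_mul]
    congr 1; ext p
    rw [← unitChar_add]; congr 1; ring
  -- With `b = 0` the third factor is μ̂(0) = 1. The form is then the ν-average of a mollification
  -- of μ, and on the Fourier side it is ∫ |ĝ(ξ/r)|² |μ̂|²/I. The sup bound on the mollification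
  -- bounds both.
  have htri := trilinear_eq g hr 1 0 ν μ μ
  have hμ0 : fourierMeasure μ 0 = 1 := by rw [fourierMeasure_eq]; simp [unitChar_zero]
  have hrhs : ∀ ξ, schwartzHat g (ξ / r) *
        (fourierMeasure μ ξ * (fourierMeasure ν (-(1 * ξ)) * fourierMeasure μ (0 * ξ)))
      = ((‖schwartzHat g (ξ / r)‖ ^ 2 * ‖fourierMeasure μ ξ‖ ^ 2 / I : ℝ) : ℂ) := by
    intro ξ
    rw [one_mul, zero_mul, hμ0, mul_one, fourierMeasure_neg, hνhat]
    push_cast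
    rw [← Complex.mul_conj', ← Complex.mul_conj', map_mul, map_div₀, Complex.conj_ofReal]
    ring
  simp_rw [hrhs] at htri
  rw [integral_complex_ofReal, Complex.ofReal_inj] at htri
  obtain ⟨B, hB, hBd⟩ := exists_norm_schwartzHat_le g
  have hint : Integrable fun ξ => ‖schwartzHat g (ξ / r)‖ ^ 2 * ‖fourierMeasure μ ξ‖ ^ 2 / I := by
    refine Integrable.div_const ?_ _
    refine (((integrable_schwartzHat g).comp_div hr.ne').norm.const_mul B).mono
      (Continuous.aestronglyMeasurable ?_) (Filter.Eventually.of_forall fun ξ => ?_)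
    · have := continuous_schwartzHat g
      have := continuous_fourierMeasure μ
      fun_prop
    · have h1 := hBd (ξ / r)
      have h2 := norm_fourierMeasure_le μ ξ
      have h3 := norm_nonneg (schwartzHat g (ξ / r))
      have h4 := norm_nonneg (fourierMeasure μ ξ)
      rw [Real.norm_of_nonneg (by positivity), Real.norm_of_nonneg (by positivity)]
      calc _ ≤ ‖schwartzHat g (ξ / r)‖ ^ 2 * 1 :=
            mul_le_mul_of_nonneg_left (pow_le_one₀ h4 h2) (by positivity)
        _ ≤ _ := by nlinarith
  have hup : ∫ ξ, ‖schwartzHat g (ξ / r)‖ ^ 2 * ‖fourierMeasure μ ξ‖ ^ 2 / I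
      ≤ r * (max A 0 * (4 / r) ^ s) := by
    rw [← htri]
    simp only [one_mul, zero_mul, sub_zero, integral_const, probReal_univ, one_smul]
    refine (integral_mono_of_nonneg (Filter.Eventually.of_forall fun x => ?_)
      (integrable_const (r * (max A 0 * (4 / r) ^ s)))
      (Filter.Eventually.of_forall fun x => mollify_le hF hg1 hg2 hr x)).trans ?_
    · exact integral_nonneg fun z => mul_nonneg hr.le (hg0 _)
    · simp
  have hconst : r * (max A 0 * (4 / r) ^ s) ≤ (4 * (max A 0 + 1) / η) * R ^ (1 - s) := by
    have h4 : (4 : ℝ) ^ s ≤ 4 := by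
      calc (4 : ℝ) ^ s ≤ 4 ^ (1 : ℝ) := Real.rpow_le_rpow_of_exponent_le (by norm_num) hs1
        _ = 4 := Real.rpow_one _
    have hηs : η ≤ η ^ (1 - s) := by
      calc η = η ^ (1 : ℝ) := (Real.rpow_one _).symm
        _ ≤ _ := Real.rpow_le_rpow_of_exponent_ge hη hη1 (by linarith)
    have e1 : r * (4 / r) ^ s = 4 ^ s * r ^ (1 - s) := by
      rw [Real.div_rpow (by norm_num) hr.le, Real.rpow_sub hr, Real.rpow_one]; ring
    have e2 : r ^ (1 - s) ≤ R ^ (1 - s) / η := by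
      rw [hrdef, Real.div_rpow (by linarith) hη.le]
      exact div_le_div_of_nonneg_left (Real.rpow_nonneg (by linarith) _) hη hηs
    have hA : 0 ≤ max A 0 := le_max_right _ _
    have hRp : 0 ≤ R ^ (1 - s) / η := div_nonneg (Real.rpow_nonneg (by linarith) _) hη.le
    calc r * (max A 0 * (4 / r) ^ s) = max A 0 * (r * (4 / r) ^ s) := by ring
      _ = max A 0 * (4 ^ s * r ^ (1 - s)) := by rw [e1]
      _ ≤ (max A 0 + 1) * (4 * (R ^ (1 - s) / η)) := by
          refine mul_le_mul (by linarith) ?_ (by positivity) (by positivity)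
          exact mul_le_mul h4 e2 (by positivity) (by norm_num)
      _ = _ := by ring
  have hset : MeasurableSet {ξ : ℝ | |ξ| ≤ R} := (isClosed_le continuous_abs continuous_const).measurableSet
  have hle : ∀ ξ ∈ {ξ : ℝ | |ξ| ≤ R}, ‖fourierMeasure μ ξ‖ ^ 2 ≤
      4 / I * (‖schwartzHat g (ξ / r)‖ ^ 2 * ‖fourierMeasure μ ξ‖ ^ 2 / I) := by
    intro ξ hξ
    have h1 := hlow (ξ / r) (by
      rw [abs_div, abs_of_pos hr, div_le_iff₀ hr, hrdef]
      field_simp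
      exact hξ)
    have h2 : I ^ 2 ≤ 4 * ‖schwartzHat g (ξ / r)‖ ^ 2 := by nlinarith
    have h3 : 0 ≤ ‖fourierMeasure μ ξ‖ ^ 2 := by positivity
    rw [show 4 / I * (‖schwartzHat g (ξ / r)‖ ^ 2 * ‖fourierMeasure μ ξ‖ ^ 2 / I)
      = (4 * ‖schwartzHat g (ξ / r)‖ ^ 2) * ‖fourierMeasure μ ξ‖ ^ 2 / I ^ 2 by field_simp,
      le_div_iff₀ (by positivity)]
    nlinarith
  calc ∫⁻ ξ in {ξ : ℝ | |ξ| ≤ R}, ENNReal.ofReal (‖fourierMeasure μ ξ‖ ^ 2)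
      ≤ ∫⁻ ξ in {ξ : ℝ | |ξ| ≤ R}, ENNReal.ofReal
          (4 / I * (‖schwartzHat g (ξ / r)‖ ^ 2 * ‖fourierMeasure μ ξ‖ ^ 2 / I)) :=
        setLIntegral_mono' hset fun ξ hξ => ENNReal.ofReal_le_ofReal (hle ξ hξ)
    _ ≤ ∫⁻ ξ, ENNReal.ofReal
          (4 / I * (‖schwartzHat g (ξ / r)‖ ^ 2 * ‖fourierMeasure μ ξ‖ ^ 2 / I)) :=
        setLIntegral_le_lintegral _ _
    _ = ENNReal.ofReal (∫ ξ,
          (4 / I * (‖schwartzHat g (ξ / r)‖ ^ 2 * ‖fourierMeasure μ ξ‖ ^ 2 / I))) := by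
        rw [ofReal_integral_eq_lintegral_ofReal (hint.const_mul _)]
        exact Filter.Eventually.of_forall fun ξ => by positivity
    _ ≤ _ := by
        apply ENNReal.ofReal_le_ofReal
        rw [integral_const_mul, mul_assoc]
        exact mul_le_mul_of_nonneg_left (hup.trans hconst) (by positivity)

/-! ### Weighted bounds and the high-frequency tail -/

/-- The integrand on the Fourier side of the trilinear form of `μ`. -/
def triple (μ : Measure ℝ) (a b ξ : ℝ) : ℂ :=
  fourierMeasure μ ξ * (fourierMeasure μ (-(a * ξ)) * fourierMeasure μ (b * ξ))

lemma continuous_triple (μ : Measure ℝ) [IsProbabilityMeasure μ] (a b : ℝ) :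
    Continuous (triple μ a b) := by
  have := continuous_fourierMeasure μ
  unfold triple; fun_prop

lemma norm_triple (μ : Measure ℝ) (a b ξ : ℝ) : ‖triple μ a b ξ‖ =
    ‖fourierMeasure μ ξ‖ * (‖fourierMeasure μ (a * ξ)‖ * ‖fourierMeasure μ (b * ξ)‖) := by
  rw [triple, norm_mul, norm_mul, norm_fourierMeasure_neg]

lemma norm_triple_le_one (μ : Measure ℝ) [IsProbabilityMeasure μ] (a b ξ : ℝ) :
    ‖triple μ a b ξ‖ ≤ 1 := by
  rw [norm_triple]
  exact mul_le_one₀ (norm_fourierMeasure_le μ _) (by positivity)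
    (mul_le_one₀ (norm_fourierMeasure_le μ _) (by positivity) (norm_fourierMeasure_le μ _))

lemma measurableSet_abs_ge (R : ℝ) : MeasurableSet {ξ : ℝ | R ≤ |ξ|} :=
  (isClosed_le continuous_const continuous_abs).measurableSet

lemma measurableSet_abs_le (R : ℝ) : MeasurableSet {ξ : ℝ | |ξ| ≤ R} :=
  (isClosed_le continuous_abs continuous_const).measurableSet

lemma lintegral_dyadic_le (f : ℝ → ENNReal) (L : ℕ) :
    ∫⁻ ξ in {ξ : ℝ | (2 : ℝ) ^ L ≤ |ξ|}, f ξ ≤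
      ∑' k : ℕ, ∫⁻ ξ in {ξ : ℝ | (2 : ℝ) ^ (L + k) ≤ |ξ| ∧ |ξ| ≤ 2 ^ (L + k + 1)}, f ξ := by
  refine le_trans (lintegral_mono_set fun ξ hξ => ?_) (lintegral_iUnion_le _ _)
  obtain ⟨n, hn1, hn2⟩ := exists_nat_pow_near (le_trans (one_le_pow₀ one_le_two) hξ)
    (one_lt_two (α := ℝ))
  have hLn : L < n + 1 := (pow_lt_pow_iff_right₀ (one_lt_two (α := ℝ))).1 (lt_of_le_of_lt hξ hn2)
  obtain ⟨k, rfl⟩ := Nat.exists_eq_add_of_le (Nat.lt_succ_iff.1 hLn)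
  exact Set.mem_iUnion.2 ⟨k, hn1, hn2.le⟩

lemma tsum_geometric_ofReal {D q : ℝ} (hD : 0 ≤ D) (hq : 0 ≤ q) (hq1 : q < 1) :
    ∑' k : ℕ, ENNReal.ofReal (D * q ^ k) = ENNReal.ofReal (D * (1 - q)⁻¹) := by
  rw [← ENNReal.ofReal_tsum_of_nonneg (fun k => by positivity)
    ((summable_geometric_of_lt_one hq hq1).mul_left D), tsum_mul_left,
    tsum_geometric_of_lt_one hq hq1]

lemma two_rpow_neg_lt_one {c : ℝ} (hc : 0 < c) : (2 : ℝ) ^ (-c) < 1 :=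
  Real.rpow_lt_one_of_one_lt_of_neg one_lt_two (by linarith)

lemma two_rpow_mul_nat (c : ℝ) (k : ℕ) : ((2 : ℝ) ^ c) ^ k = 2 ^ (c * k) := by
  rw [Real.rpow_mul zero_le_two, Real.rpow_natCast]

lemma IsFourierUniform.lintegral_shell_le {μ : Measure ℝ} {c₀ B : ℝ} {ω : ℕ → ℝ}
    (h : IsFourierUniform μ c₀ B ω) {l : ℕ} (hl : 1 ≤ l) :
    ∫⁻ ξ in shell l, ENNReal.ofReal (‖fourierMeasure μ ξ‖ ^ 4)
      ≤ ENNReal.ofReal ((B * (2 : ℝ) ^ ((ω l - c₀) * (l : ℝ))) ^ 4) := by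
  have hm : MeasurableSet (shell l) :=
    (isClosed_le continuous_const continuous_abs).measurableSet.inter
      (isClosed_le continuous_abs continuous_const).measurableSet
  have h1 := h l hl
  rw [eLpNorm_indicator_eq_eLpNorm_restrict hm,
    eLpNorm_eq_lintegral_rpow_enorm_toReal (by norm_num) (by norm_num)] at h1
  have e4 : (4 : ENNReal).toReal = ((4 : ℕ) : ℝ) := by norm_num
  rw [e4] at h1
  have h2 := pow_le_pow_left₀ zero_le h1 4
  rw [← ENNReal.rpow_natCast (_ ^ (1 / ((4 : ℕ) : ℝ))), ← ENNReal.rpow_mul,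
    one_div_mul_cancel (by norm_num), ENNReal.rpow_one] at h2
  have e5 : ∀ ξ, ENNReal.ofReal (‖fourierMeasure μ ξ‖ ^ 4)
      = ‖fourierMeasure μ ξ‖ₑ ^ (((4 : ℕ) : ℝ)) := fun ξ => by
    rw [ENNReal.rpow_natCast, ENNReal.ofReal_pow (norm_nonneg _), ofReal_norm]
  simp_rw [e5]
  refine h2.trans ?_
  -- `B` may be negative. The norm bound is then zero, although the fourth power on the right is
  -- not.
  rcases le_total 0 (B * (2 : ℝ) ^ ((ω l - c₀) * (l : ℝ))) with h0 | h0
  · rw [ENNReal.ofReal_pow h0]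
  · rw [ENNReal.ofReal_of_nonpos h0]; simp

lemma shell_of_dyadic {n : ℕ} {ξ : ℝ} (h1 : (2 : ℝ) ^ n ≤ |ξ|) (h2 : |ξ| ≤ 2 ^ (n + 1)) :
    ξ ∈ shell n := by
  constructor
  · refine le_trans ?_ h1
    rw [← Real.rpow_natCast]
    exact Real.rpow_le_rpow_of_exponent_le one_le_two (by linarith)
  · refine h2.trans_eq ?_
    rw [← Real.rpow_natCast]; push_cast; rfl

/-- Fourier uniformity as a weighted `L⁴` bound. -/
lemma IsFourierUniform.exists_weighted_le {κ : ℝ} (hκ : 0 < κ) (B : ℝ) {ω : ℕ → ℝ}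
    (hω : Filter.Tendsto ω Filter.atTop (nhds 0)) : ∃ C R : ℝ, 0 < C ∧ 1 ≤ R ∧
    ∀ μ : Measure ℝ, IsFourierUniform μ (2 * κ) B ω →
      ∫⁻ ξ in {ξ : ℝ | R ≤ |ξ|}, ENNReal.ofReal ((|ξ| ^ κ * ‖fourierMeasure μ ξ‖) ^ 4)
        ≤ ENNReal.ofReal C := by
  obtain ⟨L, hL⟩ := Filter.eventually_atTop.1
    (hω.eventually (gt_mem_nhds (show (0 : ℝ) < κ / 2 by positivity)))
  set q : ℝ := 2 ^ (-(2 * κ)) with hq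
  have hq0 : 0 ≤ q := by positivity
  have hq1 : q < 1 := two_rpow_neg_lt_one (by positivity)
  set D : ℝ := B ^ 4 * 2 ^ (4 * κ) with hD
  have hD0 : 0 ≤ D := by positivity
  -- The `+ 1` keeps the constant positive when `B = 0`. Starting at `L + 1` guarantees l ≥ 1, where
  -- uniformity is assumed.
  refine ⟨D * (1 - q)⁻¹ + 1, 2 ^ (L + 1), ?_, one_le_pow₀ one_le_two, fun μ hμ => ?_⟩
  · have : 0 < (1 - q)⁻¹ := inv_pos.2 (by linarith)
    positivity
  refine (lintegral_dyadic_le _ (L + 1)).trans ?_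
  refine le_trans (ENNReal.tsum_le_tsum (g := fun k : ℕ => ENNReal.ofReal (D * q ^ k)) fun k => ?_) ?_
  · have hm : MeasurableSet {ξ : ℝ | (2 : ℝ) ^ (L + 1 + k) ≤ |ξ| ∧ |ξ| ≤ 2 ^ (L + 1 + k + 1)} :=
      (measurableSet_abs_ge _).inter (measurableSet_abs_le _)
    set l := L + 1 + k with hl
    have hpt : ∀ ξ ∈ {ξ : ℝ | (2 : ℝ) ^ l ≤ |ξ| ∧ |ξ| ≤ 2 ^ (l + 1)},
        ENNReal.ofReal ((|ξ| ^ κ * ‖fourierMeasure μ ξ‖) ^ 4) ≤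
          ENNReal.ofReal (2 ^ (4 * κ * (l + 1))) * ENNReal.ofReal (‖fourierMeasure μ ξ‖ ^ 4) := by
      intro ξ hξ
      rw [← ENNReal.ofReal_mul (by positivity)]
      refine ENNReal.ofReal_le_ofReal ?_
      rw [mul_pow]
      refine mul_le_mul_of_nonneg_right ?_ (by positivity)
      calc (|ξ| ^ κ) ^ 4 ≤ (((2 : ℝ) ^ (l + 1)) ^ κ) ^ 4 := by
            gcongr; exact hξ.2
        _ = 2 ^ (4 * κ * (l + 1)) := by
            rw [← Real.rpow_natCast, ← Real.rpow_natCast, ← Real.rpow_mul (by positivity),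
              ← Real.rpow_mul (by norm_num)]
            congr 1; push_cast; ring
    refine (setLIntegral_mono' hm hpt).trans ?_
    rw [lintegral_const_mul' _ _ ENNReal.ofReal_ne_top]
    have hsub : {ξ : ℝ | (2 : ℝ) ^ l ≤ |ξ| ∧ |ξ| ≤ 2 ^ (l + 1)} ⊆ shell l :=
      fun ξ hξ => shell_of_dyadic hξ.1 hξ.2
    refine (mul_le_mul_right ((lintegral_mono_set hsub).trans
      (hμ.lintegral_shell_le (by omega))) _).trans ?_
    rw [← ENNReal.ofReal_mul (by positivity)]
    refine ENNReal.ofReal_le_ofReal ?_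
    have hωl := (hL l (by omega)).le
    have hl0 : (0 : ℝ) ≤ l := Nat.cast_nonneg l
    have hkl : (k : ℝ) ≤ l := by exact_mod_cast (by omega : k ≤ l)
    calc (2 : ℝ) ^ (4 * κ * (l + 1)) * (B * 2 ^ ((ω l - 2 * κ) * l)) ^ 4
        = B ^ 4 * 2 ^ (4 * κ * (l + 1) + (ω l - 2 * κ) * l * 4) := by
          rw [mul_pow, ← Real.rpow_natCast (2 ^ ((ω l - 2 * κ) * l)), ← Real.rpow_mul (by norm_num),
            Real.rpow_add (by norm_num)]
          push_cast; ring
      _ ≤ B ^ 4 * 2 ^ (4 * κ + -(2 * κ) * k) := by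
          refine mul_le_mul_of_nonneg_left ?_ (by positivity)
          refine Real.rpow_le_rpow_of_exponent_le one_le_two ?_
          -- Since ω(l) ≤ κ/2, the exponent is at most 4κ(l + 1) - 6κl = 4κ - 2κl, and k ≤ l.
          nlinarith [mul_le_mul_of_nonneg_right hωl hl0, mul_le_mul_of_nonneg_left hkl hκ.le]
      _ = D * q ^ k := by
          rw [hD, hq, two_rpow_mul_nat, Real.rpow_add (by norm_num)]; ring
  · rw [tsum_geometric_ofReal hD0 hq0 hq1]
    exact ENNReal.ofReal_le_ofReal (by linarith)

/-- The Frostman condition as a weighted `L²` bound. -/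
lemma IsFrostman.exists_weighted_le {κ : ℝ} (hκ : 0 < κ) (A : ℝ) : ∃ C : ℝ, 0 < C ∧
    ∀ (s : ℝ) (μ : Measure ℝ), 0 < s → 1 - κ ≤ s → s ≤ 1 → IsProbabilityMeasure μ →
      IsFrostman μ s A →
      ∫⁻ ξ in {ξ : ℝ | 1 ≤ |ξ|}, ENNReal.ofReal ((|ξ| ^ (-κ) * ‖fourierMeasure μ ξ‖) ^ 2)
        ≤ ENNReal.ofReal C := by
  obtain ⟨C, hC, hL2⟩ := IsFrostman.lintegral_sq_le A
  set q : ℝ := 2 ^ (-κ) with hq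
  have hq0 : 0 ≤ q := by positivity
  have hq1 : q < 1 := two_rpow_neg_lt_one hκ
  set D : ℝ := C * 2 ^ κ with hD
  have hD0 : 0 < D := by positivity
  refine ⟨D * (1 - q)⁻¹, ?_, fun s μ hs hs0 hs1 hp hμ => ?_⟩
  · have : 0 < (1 - q)⁻¹ := inv_pos.2 (by linarith)
    positivity
  have h0 := lintegral_dyadic_le
    (fun ξ => ENNReal.ofReal ((|ξ| ^ (-κ) * ‖fourierMeasure μ ξ‖) ^ 2)) 0
  rw [pow_zero] at h0
  refine h0.trans (le_trans
    (ENNReal.tsum_le_tsum (g := fun k : ℕ => ENNReal.ofReal (D * q ^ k)) fun k => ?_)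
    (tsum_geometric_ofReal hD0.le hq0 hq1).le)
  rw [zero_add]
  have hm : MeasurableSet {ξ : ℝ | (2 : ℝ) ^ k ≤ |ξ| ∧ |ξ| ≤ 2 ^ (k + 1)} :=
    (measurableSet_abs_ge _).inter (measurableSet_abs_le _)
  have hpt : ∀ ξ ∈ {ξ : ℝ | (2 : ℝ) ^ k ≤ |ξ| ∧ |ξ| ≤ 2 ^ (k + 1)},
      ENNReal.ofReal ((|ξ| ^ (-κ) * ‖fourierMeasure μ ξ‖) ^ 2) ≤
        ENNReal.ofReal (2 ^ (-(2 * κ) * k)) * ENNReal.ofReal (‖fourierMeasure μ ξ‖ ^ 2) := by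
    intro ξ hξ
    rw [← ENNReal.ofReal_mul (by positivity)]
    refine ENNReal.ofReal_le_ofReal ?_
    rw [mul_pow]
    refine mul_le_mul_of_nonneg_right ?_ (by positivity)
    calc (|ξ| ^ (-κ)) ^ 2 ≤ (((2 : ℝ) ^ k) ^ (-κ)) ^ 2 := by
          refine pow_le_pow_left₀ (by positivity) ?_ 2
          exact Real.rpow_le_rpow_of_nonpos (by positivity) hξ.1 (by linarith)
      _ = 2 ^ (-(2 * κ) * k) := by
          rw [← Real.rpow_natCast, ← Real.rpow_natCast, ← Real.rpow_mul (by norm_num),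
            ← Real.rpow_mul (by norm_num)]
          congr 1; push_cast; ring
  refine (setLIntegral_mono' hm hpt).trans ?_
  rw [lintegral_const_mul' _ _ ENNReal.ofReal_ne_top]
  have hsub : {ξ : ℝ | (2 : ℝ) ^ k ≤ |ξ| ∧ |ξ| ≤ 2 ^ (k + 1)} ⊆ {ξ : ℝ | |ξ| ≤ 2 ^ (k + 1)} :=
    fun ξ hξ => hξ.2
  refine (mul_le_mul_right ((lintegral_mono_set hsub).trans
    (hL2 s μ hs hs1 hp hμ _ (one_le_pow₀ one_le_two))) _).trans ?_
  rw [← ENNReal.ofReal_mul (by positivity)]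
  refine ENNReal.ofReal_le_ofReal ?_
  -- As 1 - s ≤ κ, the L² mass grows at most like 2^(κk), which the weight 2^(-2κk) beats.
  have h1 : ((2 : ℝ) ^ (k + 1)) ^ (1 - s) ≤ 2 ^ (κ * (k + 1)) := by
    rw [← Real.rpow_natCast, ← Real.rpow_mul (by norm_num)]
    refine Real.rpow_le_rpow_of_exponent_le one_le_two ?_
    push_cast
    nlinarith [(Nat.cast_nonneg k : (0 : ℝ) ≤ k)]
  calc (2 : ℝ) ^ (-(2 * κ) * k) * (C * (2 ^ (k + 1)) ^ (1 - s))
      ≤ 2 ^ (-(2 * κ) * k) * (C * 2 ^ (κ * (k + 1))) := by gcongr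
    _ = C * 2 ^ (-(2 * κ) * k + κ * (k + 1)) := by rw [Real.rpow_add (by norm_num)]; ring
    _ = C * 2 ^ (κ + -κ * k) := by congr 2; ring
    _ = D * q ^ k := by rw [hD, hq, two_rpow_mul_nat, Real.rpow_add (by norm_num)]; ring

lemma lintegral_dilate (f : ℝ → ENNReal) (hf : Measurable f) {a : ℝ} (ha : a ≠ 0) (R : ℝ) :
    ∫⁻ ξ in {ξ : ℝ | R ≤ |ξ|}, f (a * ξ) =
      ENNReal.ofReal |a⁻¹| * ∫⁻ η in {η : ℝ | |a| * R ≤ |η|}, f η := by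
  rw [← lintegral_indicator (measurableSet_abs_ge R),
    ← lintegral_indicator (measurableSet_abs_ge _), ← smul_eq_mul, ← lintegral_smul_measure,
    ← Real.map_volume_mul_left ha, lintegral_map (hf.indicator (measurableSet_abs_ge _))
      (by fun_prop)]
  congr 1; ext ξ
  have : 0 < |a| := abs_pos.2 ha
  simp only [Set.indicator, Set.mem_ofPred_eq, abs_mul, mul_le_mul_iff_right₀ this]

/-- The high frequencies contribute little to the trilinear form, uniformly in the measure. -/
lemma exists_tail_le {Q : ℝ} (hQ : 1 ≤ Q) (A : ℝ) {κ : ℝ} (hκ : 0 < κ) (B : ℝ) {ω : ℕ → ℝ}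
    (hω : Filter.Tendsto ω Filter.atTop (nhds 0)) : ∃ C R₀ : ℝ, 0 < C ∧ 1 ≤ R₀ ∧
    ∀ (s : ℝ) (μ : Measure ℝ) (a b : ℝ), 0 < s → 1 - κ ≤ s → s ≤ 1 → IsProbabilityMeasure μ →
      IsFrostman μ s A → IsFourierUniform μ (2 * κ) B ω → Q⁻¹ ≤ |a| → |a| ≤ Q → Q⁻¹ ≤ |b| →
      |b| ≤ Q → ∀ R, R₀ ≤ R →
      ∫⁻ ξ in {ξ : ℝ | R ≤ |ξ|}, ENNReal.ofReal ‖triple μ a b ξ‖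
        ≤ ENNReal.ofReal (C * R ^ (-κ)) := by
  obtain ⟨C₄, R₁, hC₄, hR₁, h₄⟩ := IsFourierUniform.exists_weighted_le hκ B hω
  obtain ⟨C₂, hC₂, h₂⟩ := IsFrostman.exists_weighted_le hκ A
  -- Powers Q^(4κ) and Q^(2κ) pay for moving the weight from ξ to aξ or bξ, and the extra Q for the
  -- Jacobian. The threshold `Q * R₁` keeps |aξ| and |bξ| above `R₁`.
  refine ⟨C₄ + Q ^ (4 * κ) * (Q * C₄) + Q ^ (2 * κ) * (Q * C₂), Q * R₁, by positivity,
    by nlinarith, fun s μ a b hs hs0 hs1 hp hμF hμU ha ha' hb hb' R hR => ?_⟩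
  have hQ0 : 0 < Q := by linarith
  have hQi : 0 < Q⁻¹ := inv_pos.2 hQ0
  have ha0 : 0 < |a| := hQi.trans_le ha
  have hb0 : 0 < |b| := hQi.trans_le hb
  have hR1 : R₁ ≤ R := by nlinarith
  have hR0 : 0 < R := by linarith
  have hμc := continuous_fourierMeasure μ
  set w₄ : ℝ → ℝ := fun ξ => (|ξ| ^ κ * ‖fourierMeasure μ ξ‖) ^ 4 with hw₄
  set w₂ : ℝ → ℝ := fun ξ => (|ξ| ^ (-κ) * ‖fourierMeasure μ ξ‖) ^ 2 with hw₂
  have hm₄ : Measurable fun ξ => ENNReal.ofReal (w₄ ξ) := by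
    have := hμc.measurable; simp only [hw₄]; fun_prop
  have hm₂ : Measurable fun ξ => ENNReal.ofReal (w₂ ξ) := by
    have := hμc.measurable; simp only [hw₂]; fun_prop
  have hw₄0 : ∀ ξ, 0 ≤ w₄ ξ := fun ξ => by positivity
  have hw₂0 : ∀ ξ, 0 ≤ w₂ ξ := fun ξ => by positivity
  have hpt : ∀ ξ ∈ {ξ : ℝ | R ≤ |ξ|}, ENNReal.ofReal ‖triple μ a b ξ‖ ≤
      ENNReal.ofReal (R ^ (-κ)) * (ENNReal.ofReal (w₄ ξ) + (ENNReal.ofReal (Q ^ (4 * κ)) *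
        ENNReal.ofReal (w₄ (a * ξ)) + ENNReal.ofReal (Q ^ (2 * κ)) *
        ENNReal.ofReal (w₂ (b * ξ)))) := by
    intro ξ hξ
    have hξ' : R ≤ |ξ| := hξ
    have hξ0 : 0 < |ξ| := hR0.trans_le hξ'
    rw [← ENNReal.ofReal_mul (by positivity), ← ENNReal.ofReal_mul (by positivity),
      ← ENNReal.ofReal_add (by positivity) (by positivity),
      ← ENNReal.ofReal_add (by positivity) (by positivity), ← ENNReal.ofReal_mul (by positivity)]
    refine ENNReal.ofReal_le_ofReal ?_
    rw [norm_triple]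
    -- The weights multiply to |ξ|^κ, so the product of the three transforms is |ξ|^(-κ) x y z.
    set x := |ξ| ^ κ * ‖fourierMeasure μ ξ‖ with hx
    set y := |ξ| ^ κ * ‖fourierMeasure μ (a * ξ)‖ with hy
    set z := |ξ| ^ (-κ) * ‖fourierMeasure μ (b * ξ)‖ with hz
    have hx0 : 0 ≤ x := by positivity
    have hy0 : 0 ≤ y := by positivity
    have hz0 : 0 ≤ z := by positivity
    have hpp : |ξ| ^ κ * |ξ| ^ (-κ) = 1 := by
      rw [← Real.rpow_add hξ0, add_neg_cancel, Real.rpow_zero]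
    have hprod : ‖fourierMeasure μ ξ‖ * (‖fourierMeasure μ (a * ξ)‖ * ‖fourierMeasure μ (b * ξ)‖)
        = |ξ| ^ (-κ) * (x * y * z) := by
      calc _ = (|ξ| ^ κ * |ξ| ^ (-κ)) ^ 2 * (‖fourierMeasure μ ξ‖ * (‖fourierMeasure μ (a * ξ)‖ *
            ‖fourierMeasure μ (b * ξ)‖)) := by rw [hpp]; ring
        _ = _ := by rw [hx, hy, hz]; ring
    have hdec : |ξ| ^ (-κ) ≤ R ^ (-κ) := Real.rpow_le_rpow_of_nonpos hR0 hξ' (by linarith)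
    -- Young's inequality with 1/4 + 1/4 + 1/2 = 1: two factors are measured in L⁴ and one in L².
    have hamgm : x * y * z ≤ x ^ 4 + (y ^ 4 + z ^ 2) := by
      nlinarith [sq_nonneg (x * y - z), sq_nonneg (x ^ 2 - y ^ 2), sq_nonneg (x ^ 2),
        sq_nonneg (y ^ 2), sq_nonneg z]
    have hyb : y ^ 4 ≤ Q ^ (4 * κ) * w₄ (a * ξ) := by
      have h1 : |ξ| ^ κ ≤ Q ^ κ * |a * ξ| ^ κ := by
        rw [← Real.mul_rpow hQ0.le (abs_nonneg _)]
        refine Real.rpow_le_rpow hξ0.le ?_ hκ.le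
        rw [abs_mul]
        calc |ξ| = Q * (Q⁻¹ * |ξ|) := by field_simp
          _ ≤ _ := by gcongr
      have h2 : Q ^ (4 * κ) = (Q ^ κ) ^ 4 := by
        rw [← Real.rpow_natCast, ← Real.rpow_mul hQ0.le]; congr 1; push_cast; ring
      rw [h2, hw₄, ← mul_pow]
      refine pow_le_pow_left₀ hy0 ?_ 4
      rw [← mul_assoc]
      exact mul_le_mul_of_nonneg_right h1 (norm_nonneg _)
    have hzb : z ^ 2 ≤ Q ^ (2 * κ) * w₂ (b * ξ) := by
      have h1 : |ξ| ^ (-κ) ≤ Q ^ κ * |b * ξ| ^ (-κ) := by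
        rw [Real.rpow_neg hξ0.le, Real.rpow_neg (abs_nonneg _), ← div_eq_mul_inv, ← one_div,
          div_le_div_iff₀ (by positivity) (Real.rpow_pos_of_pos (by rw [abs_mul]; positivity) _),
          one_mul, ← Real.mul_rpow hQ0.le (abs_nonneg _), abs_mul]
        exact Real.rpow_le_rpow (by positivity) (by gcongr) hκ.le
      have h2 : Q ^ (2 * κ) = (Q ^ κ) ^ 2 := by
        rw [← Real.rpow_natCast, ← Real.rpow_mul hQ0.le]; congr 1; push_cast; ring
      rw [h2, hw₂, ← mul_pow]
      refine pow_le_pow_left₀ hz0 ?_ 2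
      rw [← mul_assoc]
      exact mul_le_mul_of_nonneg_right h1 (norm_nonneg _)
    rw [hprod]
    refine mul_le_mul hdec ?_ (by positivity) (by positivity)
    have : w₄ ξ = x ^ 4 := rfl
    linarith
  refine (setLIntegral_mono' (measurableSet_abs_ge R) hpt).trans ?_
  rw [lintegral_const_mul' _ _ ENNReal.ofReal_ne_top, lintegral_add_left hm₄,
    lintegral_add_left (by fun_prop), lintegral_const_mul' _ _ ENNReal.ofReal_ne_top,
    lintegral_const_mul' _ _ ENNReal.ofReal_ne_top,
    lintegral_dilate _ hm₄ (abs_pos.1 ha0), lintegral_dilate _ hm₂ (abs_pos.1 hb0)]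
  have hW₄ : ∀ T, R₁ ≤ T → ∫⁻ ξ in {ξ : ℝ | T ≤ |ξ|}, ENNReal.ofReal (w₄ ξ) ≤ ENNReal.ofReal C₄ :=
    fun T hT => (lintegral_mono_set fun ξ hξ => hT.trans hξ).trans (h₄ μ hμU)
  have hW₂ : ∀ T, 1 ≤ T → ∫⁻ ξ in {ξ : ℝ | T ≤ |ξ|}, ENNReal.ofReal (w₂ ξ) ≤ ENNReal.ofReal C₂ :=
    fun T hT => (lintegral_mono_set fun ξ hξ => hT.trans hξ).trans (h₂ s μ hs hs0 hs1 hp hμF)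
  have hinv : ∀ {c : ℝ}, Q⁻¹ ≤ |c| → |c⁻¹| ≤ Q := fun {c} hc => by
    rw [abs_inv]; exact inv_le_of_inv_le₀ hQ0 hc
  have hbig : ∀ {c : ℝ}, Q⁻¹ ≤ |c| → R₁ ≤ |c| * R := fun {c} hc => by
    calc R₁ = Q⁻¹ * (Q * R₁) := by field_simp
      _ ≤ |c| * R := by gcongr
  calc _ ≤ ENNReal.ofReal (R ^ (-κ)) * (ENNReal.ofReal C₄ + (ENNReal.ofReal (Q ^ (4 * κ)) *
        (ENNReal.ofReal Q * ENNReal.ofReal C₄) + ENNReal.ofReal (Q ^ (2 * κ)) *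
        (ENNReal.ofReal Q * ENNReal.ofReal C₂))) := by
        gcongr
        · exact hW₄ R hR1
        · exact hinv ha
        · exact hW₄ _ (hbig ha)
        · exact hinv hb
        · exact hW₂ _ (hR₁.trans (hbig hb))
    _ = _ := by
        rw [← ENNReal.ofReal_mul hQ0.le, ← ENNReal.ofReal_mul hQ0.le,
          ← ENNReal.ofReal_mul (by positivity), ← ENNReal.ofReal_mul (by positivity),
          ← ENNReal.ofReal_add (by positivity) (by positivity),
          ← ENNReal.ofReal_add (by positivity) (by positivity),
          ← ENNReal.ofReal_mul (by positivity)]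
        congr 1; ring

lemma lintegral_eq_add_tail (f : ℝ → ENNReal) (R : ℝ) :
    ∫⁻ ξ, f ξ = (∫⁻ ξ in {ξ : ℝ | R ≤ |ξ|}, f ξ) + ∫⁻ ξ in {ξ : ℝ | R ≤ |ξ|}ᶜ, f ξ :=
  (lintegral_add_compl f (measurableSet_abs_ge R)).symm

lemma integrable_triple {μ : Measure ℝ} [IsProbabilityMeasure μ] {a b R C : ℝ}
    (h : ∫⁻ ξ in {ξ : ℝ | R ≤ |ξ|}, ENNReal.ofReal ‖triple μ a b ξ‖ ≤ ENNReal.ofReal C) :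
    Integrable (triple μ a b) := by
  refine ⟨(continuous_triple μ a b).aestronglyMeasurable, ?_⟩
  rw [hasFiniteIntegral_iff_norm, lintegral_eq_add_tail _ R]
  refine ENNReal.add_lt_top.2 ⟨h.trans_lt ENNReal.ofReal_lt_top, ?_⟩
  refine lt_of_le_of_lt (setLIntegral_mono' (g := fun _ => 1) (measurableSet_abs_ge R).compl fun ξ _ => ?_) ?_
  · exact ENNReal.ofReal_le_one.2 (norm_triple_le_one μ a b ξ)
  · rw [setLIntegral_one]
    refine lt_of_le_of_lt (measure_mono (t := Set.Icc (-R) R) fun ξ hξ => ?_) (by simp)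
    simp only [Set.mem_compl_iff, Set.mem_ofPred_eq, not_le] at hξ
    exact abs_le.1 hξ.le

/-! ### Corners and copies of {0, θ₁, θ₂} in dense sets -/

/-- The corners theorem, with the side d recorded as a nonzero integer of either sign so that
corners can be summed over a fixed finite range of d. -/
lemma exists_corner {ε : ℝ} (hε : 0 < ε) : ∃ n : ℕ, 1 ≤ n ∧
    ∀ S ⊆ Finset.range n ×ˢ Finset.range n, ε * (n : ℝ) ^ 2 ≤ S.card →
      ∃ p ∈ S, ∃ d ∈ (Finset.Icc (-(n : ℤ)) n).erase 0, ∃ q₁ ∈ S, ∃ q₂ ∈ S,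
        (q₁.1 : ℤ) = p.1 + d ∧ q₁.2 = p.2 ∧ q₂.1 = p.1 ∧ (q₂.2 : ℤ) = p.2 + d := by
  refine ⟨max 1 (cornersTheoremBound (ε / 9)), le_max_left _ _, fun S hS hcard => ?_⟩
  have h := corners_theorem_nat hε (le_max_right _ _) S hS hcard
  simp only [IsCornerFree, not_forall] at h
  obtain ⟨x₁, y₁, x₂, y₂, ⟨h1, h2, h3, h4⟩, hne⟩ := h
  have b1 := Finset.mem_product.1 (hS h1)
  have b3 := Finset.mem_product.1 (hS h3)
  simp only [Finset.mem_range] at b1 b3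
  refine ⟨(x₁, y₁), h1, (x₂ : ℤ) - x₁, ?_, (x₂, y₁), h3, (x₁, y₂), h2, by simp, rfl, rfl, ?_⟩
  · rw [Finset.mem_erase, Finset.mem_Icc]
    omega
  · simp only
    omega

/-- The integral of `1_E(z) 1_E(z + ρθ₁) 1_E(z + ρθ₂)` in `z`. -/
def cornerDensity (E : Set ℝ) (θ₁ θ₂ ρ : ℝ) : ENNReal :=
  ∫⁻ z, E.indicator 1 z * (E.indicator 1 (z + ρ * θ₁) * E.indicator 1 (z + ρ * θ₂))

lemma measurable_cornerDensity {E : Set ℝ} (hE : MeasurableSet E) (θ₁ θ₂ : ℝ) :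
    Measurable (cornerDensity E θ₁ θ₂) := by
  have he : Measurable (E.indicator (1 : ℝ → ENNReal)) := measurable_one.indicator hE
  unfold cornerDensity
  refine Measurable.lintegral_prod_right' (ν := (volume : Measure ℝ)) (f := fun p : ℝ × ℝ => E.indicator 1 p.2 *
    (E.indicator 1 (p.2 + p.1 * θ₁) * E.indicator 1 (p.2 + p.1 * θ₂))) ?_
  fun_prop

/-- Either fewer than εn² grid points fall in `E`, or they contain a corner. The map (i, j) ↦ y +
r(θ₁i + θ₂j) sends a corner of side d to z, z + drθ₁, z + drθ₂, so the double sum is at least 1,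
while the left side never exceeds n². -/
lemma grid_le_corners {ε : ℝ} (n : ℕ)
    (hn : ∀ S ⊆ Finset.range n ×ˢ Finset.range n, ε * (n : ℝ) ^ 2 ≤ S.card →
      ∃ p ∈ S, ∃ d ∈ (Finset.Icc (-(n : ℤ)) n).erase 0, ∃ q₁ ∈ S, ∃ q₂ ∈ S,
        (q₁.1 : ℤ) = p.1 + d ∧ q₁.2 = p.2 ∧ q₂.1 = p.1 ∧ (q₂.2 : ℤ) = p.2 + d)
    (E : Set ℝ) (θ₁ θ₂ r y : ℝ) :
    ∑ p ∈ Finset.range n ×ˢ Finset.range n,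
        E.indicator (1 : ℝ → ENNReal) (y + r * (θ₁ * p.1 + θ₂ * p.2)) ≤
      ENNReal.ofReal (ε * (n : ℝ) ^ 2) + (n : ENNReal) ^ 2 *
        ∑ p ∈ Finset.range n ×ˢ Finset.range n, ∑ d ∈ (Finset.Icc (-(n : ℤ)) n).erase 0,
          E.indicator 1 (y + r * (θ₁ * p.1 + θ₂ * p.2)) *
            (E.indicator 1 (y + r * (θ₁ * p.1 + θ₂ * p.2) + d * r * θ₁) *
              E.indicator 1 (y + r * (θ₁ * p.1 + θ₂ * p.2) + d * r * θ₂)) := by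
  classical
  set S := (Finset.range n ×ˢ Finset.range n).filter
    (fun p : ℕ × ℕ => y + r * (θ₁ * p.1 + θ₂ * p.2) ∈ E) with hS
  have hN : ∑ p ∈ Finset.range n ×ˢ Finset.range n,
      E.indicator (1 : ℝ → ENNReal) (y + r * (θ₁ * p.1 + θ₂ * p.2)) = (S.card : ENNReal) := by
    rw [hS, Finset.card_filter, Nat.cast_sum]
    refine Finset.sum_congr rfl fun p _ => ?_
    by_cases h : y + r * (θ₁ * p.1 + θ₂ * p.2) ∈ E <;> simp [h]
  rw [hN]
  by_cases hc : ε * (n : ℝ) ^ 2 ≤ S.card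
  · obtain ⟨p, hp, d, hd, q₁, hq₁, q₂, hq₂, e1, e2, e3, e4⟩ :=
      hn S (Finset.filter_subset _ _) hc
    have hpE := (Finset.mem_filter.1 hp).2
    have hq₁E := (Finset.mem_filter.1 hq₁).2
    have hq₂E := (Finset.mem_filter.1 hq₂).2
    have e1' : (q₁.1 : ℝ) = p.1 + d := by exact_mod_cast e1
    have e4' : (q₂.2 : ℝ) = p.2 + d := by exact_mod_cast e4
    rw [e1', e2] at hq₁E
    rw [e3, e4'] at hq₂E
    have f1 : y + r * (θ₁ * (p.1 + d) + θ₂ * p.2)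
      = y + r * (θ₁ * p.1 + θ₂ * p.2) + d * r * θ₁ := by ring
    have f2 : y + r * (θ₁ * p.1 + θ₂ * (p.2 + d))
      = y + r * (θ₁ * p.1 + θ₂ * p.2) + d * r * θ₂ := by ring
    rw [f1] at hq₁E
    rw [f2] at hq₂E
    have hone : (1 : ENNReal) ≤
        ∑ p ∈ Finset.range n ×ˢ Finset.range n, ∑ d ∈ (Finset.Icc (-(n : ℤ)) n).erase 0,
          E.indicator 1 (y + r * (θ₁ * p.1 + θ₂ * p.2)) *
            (E.indicator 1 (y + r * (θ₁ * p.1 + θ₂ * p.2) + d * r * θ₁) *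
              E.indicator 1 (y + r * (θ₁ * p.1 + θ₂ * p.2) + d * r * θ₂)) := by
      refine le_trans ?_ (Finset.single_le_sum (fun _ _ => zero_le) (Finset.mem_filter.1 hp).1)
      refine le_trans ?_ (Finset.single_le_sum (fun _ _ => zero_le) hd)
      simp [hpE, hq₁E, hq₂E]
    have hcard : (S.card : ENNReal) ≤ (n : ENNReal) ^ 2 := by
      have : S.card ≤ n ^ 2 := by
        refine (Finset.card_filter_le _ _).trans ?_
        rw [Finset.card_product, Finset.card_range, sq]
      exact_mod_cast this
    calc (S.card : ENNReal) ≤ (n : ENNReal) ^ 2 * 1 := by rw [mul_one]; exact hcard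
      _ ≤ _ := (mul_le_mul_right hone _).trans le_add_self
  · push Not at hc
    refine le_trans ?_ le_self_add
    rw [← ENNReal.ofReal_natCast]
    exact ENNReal.ofReal_le_ofReal hc.le

lemma lintegral_dilate_univ (f : ℝ → ENNReal) (hf : Measurable f) {a : ℝ} (ha : a ≠ 0) :
    ∫⁻ ξ, f (a * ξ) = ENNReal.ofReal |a⁻¹| * ∫⁻ η, f η := by
  rw [← smul_eq_mul, ← lintegral_smul_measure, ← Real.map_volume_mul_left ha,
    lintegral_map hf (by fun_prop)]

/-- A dense subset of a bounded interval contains many translated and dilated copies of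
`{0, θ₁, θ₂}`. -/
lemma exists_lintegral_cornerDensity_ge {Q δ : ℝ} (hQ : 1 ≤ Q) (hδ : 0 < δ) :
    ∃ c : ℝ, 0 < c ∧ ∀ (θ₁ θ₂ : ℝ) (E : Set ℝ), |θ₁| ≤ Q → |θ₂| ≤ Q → MeasurableSet E →
      E ⊆ Set.Icc (-1) 2 → ENNReal.ofReal δ ≤ volume E →
      ENNReal.ofReal c ≤ ∫⁻ ρ, cornerDensity E θ₁ θ₂ ρ := by
  -- The relevant y lie in an interval of length 5, so density δ/10 costs only δ/2 after
  -- integration.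
  obtain ⟨n, hn1, hn⟩ := exists_corner (ε := δ / 10) (by positivity)
  have hn0 : (0 : ℝ) < n := by exact_mod_cast hn1
  have hQ0 : 0 < Q := by linarith
  -- For r ≤ r₀ the grid has displacement at most 1, so only y in [-2, 3] can meet `E`.
  set r₀ : ℝ := 1 / (2 * Q * n) with hr₀
  have hr₀0 : 0 < r₀ := by positivity
  set D := (Finset.Icc (-(n : ℤ)) n).erase 0 with hD
  have hDcard : D.card = 2 * n := by
    rw [hD, Finset.card_erase_of_mem (by simp), Int.card_Icc]; omega
  refine ⟨r₀ * (δ / 2) / (2 * n ^ 3), by positivity, fun θ₁ θ₂ E hθ₁ hθ₂ hE hE' hvol => ?_⟩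
  set e : ℝ → ENNReal := E.indicator 1 with he
  have hem : Measurable e := measurable_one.indicator hE
  set G := Finset.range n ×ˢ Finset.range n with hG
  have hGcard : (G.card : ENNReal) = (n : ENNReal) ^ 2 := by
    rw [hG, Finset.card_product, Finset.card_range, sq]; push_cast; rfl
  have hn2 : ((n : ENNReal) ^ 2) ≠ 0 := by
    have : (n : ENNReal) ≠ 0 := by exact_mod_cast (by omega : n ≠ 0)
    exact pow_ne_zero 2 this
  have hn2' : ((n : ENNReal) ^ 2) ≠ ⊤ := ENNReal.pow_ne_top (ENNReal.natCast_ne_top n)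
  have key : ∀ r ∈ Set.Ioc 0 r₀, ENNReal.ofReal (δ / 2) ≤
      (n : ENNReal) ^ 2 * ∑ d ∈ D, cornerDensity E θ₁ θ₂ (d * r) := by
    intro r hr
    have hoff : ∀ p ∈ G, |r * (θ₁ * p.1 + θ₂ * p.2)| ≤ 1 := by
      intro p hp
      have hp' := Finset.mem_product.1 hp
      simp only [Finset.mem_range] at hp'
      have h1 : (p.1 : ℝ) ≤ n := by exact_mod_cast hp'.1.le
      have h2 : (p.2 : ℝ) ≤ n := by exact_mod_cast hp'.2.le
      rw [abs_mul, abs_of_pos hr.1]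
      have h3 : |θ₁ * p.1 + θ₂ * p.2| ≤ 2 * Q * n := by
        refine (abs_add_le _ _).trans ?_
        rw [abs_mul, abs_mul, Nat.abs_cast, Nat.abs_cast]
        have := mul_le_mul hθ₁ h1 (by positivity) hQ0.le
        have := mul_le_mul hθ₂ h2 (by positivity) hQ0.le
        linarith
      calc r * |θ₁ * p.1 + θ₂ * p.2| ≤ r₀ * (2 * Q * n) :=
            mul_le_mul hr.2 h3 (abs_nonneg _) hr₀0.le
        _ = 1 := by rw [hr₀]; field_simp
    -- By translation invariance each grid point contributes the full measure of `E`.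
    have hN : ∫⁻ y, ∑ p ∈ G, e (y + r * (θ₁ * p.1 + θ₂ * p.2)) = (n : ENNReal) ^ 2 * volume E := by
      rw [lintegral_finsetSum _ fun p _ => by fun_prop]
      simp_rw [lintegral_add_right_eq_self e]
      rw [Finset.sum_const, nsmul_eq_mul, hGcard, he, lintegral_indicator_one hE]
    have hT : ∫⁻ y, ∑ p ∈ G, ∑ d ∈ D, e (y + r * (θ₁ * p.1 + θ₂ * p.2)) *
            (e (y + r * (θ₁ * p.1 + θ₂ * p.2) + d * r * θ₁) *
              e (y + r * (θ₁ * p.1 + θ₂ * p.2) + d * r * θ₂))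
        = (n : ENNReal) ^ 2 * ∑ d ∈ D, cornerDensity E θ₁ θ₂ (d * r) := by
      rw [lintegral_finsetSum _ fun p _ => by fun_prop, ← hGcard, ← nsmul_eq_mul,
        ← Finset.sum_const]
      refine Finset.sum_congr rfl fun p _ => ?_
      rw [lintegral_finsetSum _ fun d _ => by fun_prop]
      refine Finset.sum_congr rfl fun d _ => ?_
      exact lintegral_add_right_eq_self
        (fun z => e z * (e (z + d * r * θ₁) * e (z + d * r * θ₂))) _
    have hpt : ∀ y, ∑ p ∈ G, e (y + r * (θ₁ * p.1 + θ₂ * p.2)) ≤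
        (Set.Icc (-2 : ℝ) 3).indicator (fun _ => ENNReal.ofReal (δ / 10 * (n : ℝ) ^ 2)) y +
        (n : ENNReal) ^ 2 * ∑ p ∈ G, ∑ d ∈ D, e (y + r * (θ₁ * p.1 + θ₂ * p.2)) *
            (e (y + r * (θ₁ * p.1 + θ₂ * p.2) + d * r * θ₁) *
              e (y + r * (θ₁ * p.1 + θ₂ * p.2) + d * r * θ₂)) := by
      intro y
      by_cases hy : y ∈ Set.Icc (-2 : ℝ) 3
      · rw [Set.indicator_of_mem hy]
        exact grid_le_corners n hn E θ₁ θ₂ r y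
      · refine le_trans (le_of_eq ?_) zero_le
        refine Finset.sum_eq_zero fun p hp => Set.indicator_of_notMem (fun hmem => hy ?_) _
        have h1 := hE' hmem
        have h2 := abs_le.1 (hoff p hp)
        exact ⟨by linarith [h1.1], by linarith [h1.2]⟩
    have hle := lintegral_mono (μ := volume) hpt
    rw [hN, lintegral_add_left (measurable_const.indicator measurableSet_Icc),
      lintegral_indicator_const measurableSet_Icc, lintegral_const_mul' _ _ hn2', hT,
      Real.volume_Icc] at hle
    have hsplit : ENNReal.ofReal (δ / 10 * (n : ℝ) ^ 2) * ENNReal.ofReal (3 - -2)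
        = (n : ENNReal) ^ 2 * ENNReal.ofReal (δ / 2) := by
      rw [← ENNReal.ofReal_mul (by positivity), ← ENNReal.ofReal_natCast,
        ← ENNReal.ofReal_pow hn0.le, ← ENNReal.ofReal_mul (by positivity)]
      congr 1; ring
    rw [hsplit, ← mul_add, ENNReal.mul_le_mul_iff_right hn2 hn2'] at hle
    have h1 : ENNReal.ofReal (δ / 2) + ENNReal.ofReal (δ / 2) = ENNReal.ofReal δ := by
      rw [← ENNReal.ofReal_add (by positivity) (by positivity)]; congr 1; ring
    rw [← ENNReal.add_le_add_iff_left (a := ENNReal.ofReal (δ / 2)) ENNReal.ofReal_ne_top, h1]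
    exact hvol.trans hle
  have hcm := measurable_cornerDensity hE θ₁ θ₂
  have hint : ENNReal.ofReal (δ / 2) * ENNReal.ofReal r₀ ≤
      (n : ENNReal) ^ 2 * ((2 * n : ℕ) * ∫⁻ ρ, cornerDensity E θ₁ θ₂ ρ) := by
    calc ENNReal.ofReal (δ / 2) * ENNReal.ofReal r₀
        = ∫⁻ _ in Set.Ioc 0 r₀, ENNReal.ofReal (δ / 2) := by
          rw [setLIntegral_const, Real.volume_Ioc, sub_zero]
      _ ≤ ∫⁻ r in Set.Ioc 0 r₀, (n : ENNReal) ^ 2 * ∑ d ∈ D, cornerDensity E θ₁ θ₂ (d * r) :=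
          setLIntegral_mono' measurableSet_Ioc key
      _ ≤ ∫⁻ r, (n : ENNReal) ^ 2 * ∑ d ∈ D, cornerDensity E θ₁ θ₂ (d * r) :=
          setLIntegral_le_lintegral _ _
      _ = (n : ENNReal) ^ 2 * ∑ d ∈ D, ∫⁻ r, cornerDensity E θ₁ θ₂ (d * r) := by
          rw [lintegral_const_mul' _ _ hn2', lintegral_finsetSum _ fun d _ => by fun_prop]
      _ ≤ (n : ENNReal) ^ 2 * ∑ d ∈ D, ∫⁻ r, cornerDensity E θ₁ θ₂ r := by
          refine mul_le_mul_right (Finset.sum_le_sum fun d hd => ?_) _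
          have hd0 : d ≠ 0 := (Finset.mem_erase.1 hd).1
          -- The substitution ρ = dr has Jacobian 1/|d| ≤ 1, because d is a nonzero integer.
          rw [lintegral_dilate_univ _ hcm (by exact_mod_cast hd0)]
          refine (mul_le_mul_left (ENNReal.ofReal_le_one.2 ?_) _).trans_eq (one_mul _)
          rw [abs_inv]
          refine inv_le_one_of_one_le₀ ?_
          exact_mod_cast Int.one_le_abs hd0
      _ = _ := by rw [Finset.sum_const, hDcard, nsmul_eq_mul]
  have h3 : ((n : ENNReal) ^ 2) * (2 * n : ℕ) = ENNReal.ofReal (2 * n ^ 3) := by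
    rw [← ENNReal.ofReal_natCast, ← ENNReal.ofReal_natCast, ← ENNReal.ofReal_pow hn0.le,
      ← ENNReal.ofReal_mul (by positivity)]
    congr 1; push_cast; ring
  rw [← mul_assoc, h3, ← ENNReal.ofReal_mul (by positivity)] at hint
  rw [ENNReal.ofReal_div_of_pos (by positivity), mul_comm r₀]
  exact ENNReal.div_le_of_le_mul' hint

/-! ### Mass near the plane z = ax - bt -/

lemma measurable_measure_window (μ : Measure ℝ) [IsProbabilityMeasure μ] (h : ℝ) :
    Measurable fun x => μ (Set.Icc (x - h) (x + h)) := by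
  have hS : MeasurableSet {p : ℝ × ℝ | p.1 - h ≤ p.2 ∧ p.2 ≤ p.1 + h} :=
    MeasurableSet.inter (s₁ := {p : ℝ × ℝ | p.1 - h ≤ p.2}) (s₂ := {p : ℝ × ℝ | p.2 ≤ p.1 + h})
      (measurableSet_le (by fun_prop) (by fun_prop)) (measurableSet_le (by fun_prop) (by fun_prop))
  exact measurable_measure_prodMk_left hS

lemma lintegral_measure_window (μ : Measure ℝ) [IsProbabilityMeasure μ] (h : ℝ) :
    ∫⁻ x, μ (Set.Icc (x - h) (x + h)) = ENNReal.ofReal (2 * h) := by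
  have hS : MeasurableSet {p : ℝ × ℝ | p.1 - h ≤ p.2 ∧ p.2 ≤ p.1 + h} :=
    MeasurableSet.inter (s₁ := {p : ℝ × ℝ | p.1 - h ≤ p.2}) (s₂ := {p : ℝ × ℝ | p.2 ≤ p.1 + h})
      (measurableSet_le (by fun_prop) (by fun_prop)) (measurableSet_le (by fun_prop) (by fun_prop))
  have h1 := Measure.prod_apply (μ := volume) (ν := μ) hS
  rw [Measure.prod_apply_symm hS] at h1
  have h2 : ∀ y : ℝ, (fun x => (x, y)) ⁻¹' {p : ℝ × ℝ | p.1 - h ≤ p.2 ∧ p.2 ≤ p.1 + h}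
      = Set.Icc (y - h) (y + h) := by
    intro y; ext x
    simp only [Set.mem_preimage, Set.mem_ofPred_eq, Set.mem_Icc]
    constructor <;> rintro ⟨h1, h2⟩ <;> constructor <;> linarith
  simp_rw [h2, Real.volume_Icc, show ∀ y : ℝ, y + h - (y - h) = 2 * h by intro y; ring] at h1
  rw [lintegral_const, measure_univ, mul_one] at h1
  exact h1.symm

/-- A probability measure on `[0, 1]` with bounded density at scale `h` gives mass `≳ h` to the
`h`-neighbourhood of the plane `z = a x - b t`. -/
lemma exists_neighbourhood_ge {Q K : ℝ} (hQ : 1 ≤ Q) (hK : 0 < K) :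
    ∃ c : ℝ, 0 < c ∧ ∀ (θ₁ θ₂ a b h : ℝ) (μ : Measure ℝ), IsProbabilityMeasure μ →
      μ (Set.Icc 0 1)ᶜ = 0 → Q⁻¹ ≤ |θ₁| → |θ₁| ≤ Q → |θ₂| ≤ Q → |a| ≤ Q → |b| ≤ Q →
      a - b = 1 → a * θ₁ = b * θ₂ → 0 < h → h ≤ 1 →
      (∀ x, μ (Set.Icc (x - h) (x + h)) ≤ ENNReal.ofReal (2 * h * K)) →
      ENNReal.ofReal (c * h) ≤ (μ.prod (μ.prod μ))
        {p : ℝ × ℝ × ℝ | |a * p.2.1 - b * p.1 - p.2.2| ≤ (1 + 2 * Q) * h} := by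
  obtain ⟨c, hc, hcorner⟩ := exists_lintegral_cornerDensity_ge hQ
    (δ := 1 / (2 * K)) (by positivity)
  have hQ0 : 0 < Q := by linarith
  -- 216 = 27 · 8: three windows of mass at least h/3 each, against fibres of area at most 8h²Q.
  refine ⟨c / (216 * Q), by positivity, ?_⟩
  intro θ₁ θ₂ a b h μ hμ hsupp hθ₁ hθ₁' hθ₂ ha hb hab hθ hh hh1 hbd
  set m : ℝ → ENNReal := fun x => μ (Set.Icc (x - h) (x + h)) with hm
  have hmm : Measurable m := measurable_measure_window μ h
  set E : Set ℝ := Set.Icc (-1) 2 ∩ {x | ENNReal.ofReal (h / 3) ≤ m x} with hE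
  have hEm : MeasurableSet E := measurableSet_Icc.inter (measurableSet_le measurable_const hmm)
  have hm0 : ∀ x, x ∉ Set.Icc (-1 : ℝ) 2 → m x = 0 := by
    intro x hx
    refine measure_mono_null (t := (Set.Icc (0 : ℝ) 1)ᶜ) (fun u hu hu' => hx ?_) hsupp
    exact ⟨by linarith [hu.2, hu'.1], by linarith [hu.1, hu'.2]⟩
  -- The windows have total integral 2h. Points of [-1, 2] outside `E` account for at most 3 · h/3 =
  -- h, so h ≤ 2hK|E|.
  have hvol : ENNReal.ofReal (1 / (2 * K)) ≤ volume E := by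
    have hpt : ∀ x, m x ≤ (Set.Icc (-1 : ℝ) 2).indicator (fun _ => ENNReal.ofReal (h / 3)) x +
        E.indicator (fun _ => ENNReal.ofReal (2 * h * K)) x := by
      intro x
      by_cases hx : x ∈ Set.Icc (-1 : ℝ) 2
      · by_cases hxE : ENNReal.ofReal (h / 3) ≤ m x
        · rw [Set.indicator_of_mem (show x ∈ E from ⟨hx, hxE⟩)]
          exact (hbd x).trans le_add_self
        · rw [Set.indicator_of_mem hx]
          exact (not_le.1 hxE).le.trans le_self_add
      · rw [hm0 x hx]; exact zero_le
    have hle := lintegral_mono (μ := volume) hpt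
    rw [lintegral_measure_window, lintegral_add_left (measurable_const.indicator measurableSet_Icc),
      lintegral_indicator_const measurableSet_Icc, lintegral_indicator_const hEm,
      Real.volume_Icc, ← ENNReal.ofReal_mul (by positivity)] at hle
    have e1 : ENNReal.ofReal (2 * h) = ENNReal.ofReal (h / 3 * (2 - -1)) + ENNReal.ofReal h := by
      rw [← ENNReal.ofReal_add (by linarith) hh.le]; congr 1; ring
    rw [e1, ENNReal.add_le_add_iff_left ENNReal.ofReal_ne_top] at hle
    have e2 : (1 : ℝ) / (2 * K) = h / (2 * h * K) := by field_simp
    rw [e2, ENNReal.ofReal_div_of_pos (by positivity)]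
    exact ENNReal.div_le_of_le_mul' hle
  have hJ := hcorner θ₁ θ₂ E hθ₁' hθ₂ hEm Set.inter_subset_left hvol
  set V : Set (ℝ × ℝ × ℝ) := {p | |a * p.2.1 - b * p.1 - p.2.2| ≤ (1 + 2 * Q) * h} with hV
  have hVm : MeasurableSet V := (isClosed_le (by fun_prop) (by fun_prop)).measurableSet
  set P := μ.prod (μ.prod μ) with hP
  -- the incidence set between `q = (ρ, z)` and `p = (t₀, x₀, z₀)`
  set W : Set ((ℝ × ℝ) × (ℝ × ℝ × ℝ)) := {w |
    |w.1.2 + w.1.1 * θ₂ - w.2.1| ≤ h ∧ |w.1.2 + w.1.1 * θ₁ - w.2.2.1| ≤ h ∧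
      |w.1.2 - w.2.2.2| ≤ h} with hW
  have hWm : MeasurableSet W := by
    refine MeasurableSet.inter (s₁ := {w : (ℝ × ℝ) × (ℝ × ℝ × ℝ) | |w.1.2 + w.1.1 * θ₂ - w.2.1| ≤ h})
      (s₂ := {w : (ℝ × ℝ) × (ℝ × ℝ × ℝ) | |w.1.2 + w.1.1 * θ₁ - w.2.2.1| ≤ h ∧ |w.1.2 - w.2.2.2| ≤ h})
      (isClosed_le (by fun_prop) (by fun_prop)).measurableSet ?_
    exact MeasurableSet.inter (s₁ := {w : (ℝ × ℝ) × (ℝ × ℝ × ℝ) | |w.1.2 + w.1.1 * θ₁ - w.2.2.1| ≤ h})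
      (s₂ := {w : (ℝ × ℝ) × (ℝ × ℝ × ℝ) | |w.1.2 - w.2.2.2| ≤ h}) (isClosed_le (by fun_prop) (by fun_prop)).measurableSet
      (isClosed_le (by fun_prop) (by fun_prop)).measurableSet
  have hwin : ∀ x u : ℝ, |x - u| ≤ h ↔ u ∈ Set.Icc (x - h) (x + h) := by
    intro x u
    rw [abs_le, Set.mem_Icc]
    constructor <;> rintro ⟨h1, h2⟩ <;> constructor <;> linarith
  have hslice : ∀ q : ℝ × ℝ, P (Prod.mk q ⁻¹' W) =
      m (q.2 + q.1 * θ₂) * (m (q.2 + q.1 * θ₁) * m q.2) := by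
    intro q
    have : Prod.mk q ⁻¹' W = Set.Icc (q.2 + q.1 * θ₂ - h) (q.2 + q.1 * θ₂ + h) ×ˢ
        (Set.Icc (q.2 + q.1 * θ₁ - h) (q.2 + q.1 * θ₁ + h) ×ˢ Set.Icc (q.2 - h) (q.2 + h)) := by
      ext p
      simp only [hW, Set.mem_preimage, Set.mem_ofPred_eq, Set.mem_prod, hwin]
    rw [this, hP, Measure.prod_prod, Measure.prod_prod]
  -- Double counting of `W`: slices at fixed (ρ, z) are boxes, whose mass is at least (h/3)³ on the
  -- copies of {0, θ₁, θ₂} in `E`.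
  have hlow : ENNReal.ofReal (h ^ 3 / 27 * c) ≤ ((volume.prod volume).prod P) W := by
    rw [Measure.prod_apply hWm]
    simp_rw [hslice]
    rw [lintegral_prod _ (by fun_prop)]
    have hpt : ∀ ρ, ENNReal.ofReal (h ^ 3 / 27) * cornerDensity E θ₁ θ₂ ρ ≤
        ∫⁻ z, m (z + ρ * θ₂) * (m (z + ρ * θ₁) * m z) := by
      intro ρ
      rw [cornerDensity, ← lintegral_const_mul' _ _ ENNReal.ofReal_ne_top]
      refine lintegral_mono fun z => ?_
      have hb : ∀ x, ENNReal.ofReal (h / 3) * E.indicator 1 x ≤ m x := by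
        intro x
        by_cases hx : x ∈ E
        · rw [Set.indicator_of_mem hx, Pi.one_apply, mul_one]; exact hx.2
        · rw [Set.indicator_of_notMem hx, mul_zero]; exact zero_le
      have e3 : ENNReal.ofReal (h ^ 3 / 27) = ENNReal.ofReal (h / 3) *
          (ENNReal.ofReal (h / 3) * ENNReal.ofReal (h / 3)) := by
        rw [← ENNReal.ofReal_mul (by positivity), ← ENNReal.ofReal_mul (by positivity)]
        congr 1; ring
      calc _ = (ENNReal.ofReal (h / 3) * E.indicator 1 (z + ρ * θ₂)) *
            ((ENNReal.ofReal (h / 3) * E.indicator 1 (z + ρ * θ₁)) *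
              (ENNReal.ofReal (h / 3) * E.indicator 1 z)) := by rw [e3]; ring
        _ ≤ _ := mul_le_mul' (hb _) (mul_le_mul' (hb _) (hb _))
    refine le_trans ?_ (lintegral_mono hpt)
    rw [lintegral_const_mul' _ _ ENNReal.ofReal_ne_top, ENNReal.ofReal_mul (by positivity)]
    exact mul_le_mul_right hJ _
  -- At fixed p the slice is empty unless p is in `V`; otherwise z is known to within h and ρ to
  -- within 2hQ, because |θ₁| ≥ 1/Q.
  have hupp : ((volume.prod volume).prod P) W ≤ ENNReal.ofReal (8 * h ^ 2 * Q) * P V := by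
    rw [Measure.prod_apply_symm hWm, ← lintegral_indicator_const hVm]
    refine lintegral_mono fun p => ?_
    by_cases hp : p ∈ V
    · rw [Set.indicator_of_mem hp]
      have hθ0 : 0 < |θ₁| := (inv_pos.2 hQ0).trans_le hθ₁
      have hsub : (fun q => (q, p)) ⁻¹' W ⊆
          Set.Icc ((p.2.1 - p.2.2) / θ₁ - 2 * h * Q) ((p.2.1 - p.2.2) / θ₁ + 2 * h * Q) ×ˢ
            Set.Icc (p.2.2 - h) (p.2.2 + h) := by
        rintro q ⟨-, h2, h3⟩
        simp only at h2 h3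
        refine ⟨?_, ?_⟩
        · have h4 : |q.1 * θ₁ - (p.2.1 - p.2.2)| ≤ 2 * h := by
            rw [abs_le] at h2 h3 ⊢
            constructor <;> linarith [h2.1, h2.2, h3.1, h3.2]
          have h5 : |q.1 - (p.2.1 - p.2.2) / θ₁| ≤ 2 * h * Q := by
            have : q.1 - (p.2.1 - p.2.2) / θ₁ = (q.1 * θ₁ - (p.2.1 - p.2.2)) / θ₁ := by
              have := abs_pos.1 hθ0
              field_simp
            rw [this, abs_div, div_eq_mul_inv]
            exact mul_le_mul h4 (inv_le_of_inv_le₀ hQ0 hθ₁) (by positivity) (by positivity)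
          rw [abs_le] at h5
          constructor <;> linarith [h5.1, h5.2]
        · rw [abs_le] at h3
          constructor <;> linarith [h3.1, h3.2]
      refine (measure_mono hsub).trans_eq ?_
      rw [Measure.prod_prod, Real.volume_Icc, Real.volume_Icc, ← ENNReal.ofReal_mul]
      · congr 1; ring
      · nlinarith [mul_pos hh hQ0]
    · rw [Set.indicator_of_notMem hp]
      refine le_of_eq ?_
      convert measure_empty (μ := (volume.prod volume : Measure (ℝ × ℝ)))
      rw [Set.eq_empty_iff_forall_notMem]
      rintro q ⟨h1, h2, h3⟩
      simp only at h1 h2 h3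
      refine hp ?_
      -- The two relations on `a` and `b` say exactly that (t, x, z) = (z + ρθ₂, z + ρθ₁, z) lies on
      -- the plane; only the three errors of size h remain.
      have h4 : a * p.2.1 - b * p.1 - p.2.2 = -(a * (q.2 + q.1 * θ₁ - p.2.1)) +
          b * (q.2 + q.1 * θ₂ - p.1) + (q.2 - p.2.2) := by
        linear_combination q.2 * hab + q.1 * hθ
      change |a * p.2.1 - b * p.1 - p.2.2| ≤ (1 + 2 * Q) * h
      rw [h4]
      refine (abs_add_three _ _ _).trans ?_
      rw [abs_neg, abs_mul, abs_mul]
      have h5 := mul_le_mul ha h2 (abs_nonneg _) hQ0.le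
      have h6 := mul_le_mul hb h1 (abs_nonneg _) hQ0.le
      linarith
  have hfin := hlow.trans hupp
  have e4 : c / (216 * Q) * h = (h ^ 3 / 27 * c) / (8 * h ^ 2 * Q) := by field_simp; norm_num
  rw [e4, ENNReal.ofReal_div_of_pos (by positivity)]
  exact ENNReal.div_le_of_le_mul' hfin

/-! ### The Littlewood-Paley series as a frequency integral -/

lemma formAt_conv_eq (g : 𝓢(ℝ, ℝ)) (l : ℕ) (θ₁ θ₂ : ℝ) (μ : Measure ℝ)
    [IsProbabilityMeasure μ] :
    ((formAt θ₁ θ₂ (conv g l μ) μ : ℝ) : ℂ) =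
      ∫ ξ, schwartzHat g (ξ / 2 ^ l) *
        triple μ (θ₂ / (θ₂ - θ₁)) (θ₁ / (θ₂ - θ₁)) ξ := by
  have h := trilinear_eq g (r := (2 : ℝ) ^ l) (by positivity) (θ₂ / (θ₂ - θ₁)) (θ₁ / (θ₂ - θ₁)) μ μ μ
  simp only [triple]
  rw [← h]
  simp only [formAt, conv]
  have : ∀ x t : ℝ, (θ₂ * x - θ₁ * t) / (θ₂ - θ₁)
      = θ₂ / (θ₂ - θ₁) * x - θ₁ / (θ₂ - θ₁) * t := fun x t => by ring
  simp_rw [this]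

/-- If ψ̂ lives on r₁ ≤ |ξ| ≤ r₂ and 2^k > r₂/r₁, at most k consecutive dilates are nonzero at any
ξ. The bound is uniform in ξ and supplies the domination for exchanging sum and integral. -/
lemma IsLittlewoodPaley.exists_tsum_le {φ ψ : 𝓢(ℝ, ℝ)} (h : IsLittlewoodPaley φ ψ) :
    ∃ C : ENNReal, C ≠ ⊤ ∧ ∀ ξ : ℝ, ∑' l : ℕ, ‖schwartzHat ψ (ξ / 2 ^ (l + 1))‖ₑ ≤ C := by
  obtain ⟨B, hB, hBd⟩ := exists_norm_schwartzHat_le ψ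
  obtain ⟨r₂, hr₂⟩ := h.hasCompactSupport.isCompact.isBounded.exists_norm_le
  obtain ⟨r₁, hr₁, hball⟩ := Metric.isOpen_iff.1 (isClosed_tsupport (schwartzHat ψ)).isOpen_compl 0
    h.zero_notMem
  have hsupp : ∀ ξ, schwartzHat ψ ξ ≠ 0 → r₁ ≤ |ξ| ∧ |ξ| ≤ r₂ := by
    intro ξ hξ
    have hmem := subset_tsupport _ (Function.mem_support.2 hξ)
    refine ⟨?_, hr₂ ξ hmem⟩
    by_contra hlt
    push Not at hlt
    exact hball (by simpa using hlt) hmem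
  obtain ⟨k, hk⟩ := pow_unbounded_of_one_lt (r₂ / r₁) (one_lt_two (α := ℝ))
  refine ⟨k * ENNReal.ofReal B, ENNReal.mul_ne_top (ENNReal.natCast_ne_top k) ENNReal.ofReal_ne_top,
    fun ξ => ?_⟩
  classical
  by_cases hex : ∃ l : ℕ, schwartzHat ψ (ξ / 2 ^ (l + 1)) ≠ 0
  · set l₀ := Nat.find hex with hl₀
    have h0 := hsupp _ (Nat.find_spec hex)
    have hout : ∀ l ∉ Finset.Ico l₀ (l₀ + k), ‖schwartzHat ψ (ξ / 2 ^ (l + 1))‖ₑ = 0 := by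
      intro l hl
      by_contra hne
      have hne' : schwartzHat ψ (ξ / 2 ^ (l + 1)) ≠ 0 := by simpa using hne
      have hl1 : l₀ ≤ l := Nat.find_min' hex hne'
      have hl2 : l₀ + k ≤ l := by
        by_contra hlt
        exact hl (Finset.mem_Ico.2 ⟨hl1, by omega⟩)
      have h1 := hsupp _ hne'
      rw [← hl₀] at h0
      rw [abs_div, abs_of_pos (by positivity : (0 : ℝ) < 2 ^ (l + 1)),
        le_div_iff₀ (by positivity)] at h1
      rw [abs_div, abs_of_pos (by positivity : (0 : ℝ) < 2 ^ (l₀ + 1)),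
        div_le_iff₀ (by positivity)] at h0
      have h2 : (2 : ℝ) ^ (l₀ + k + 1) ≤ 2 ^ (l + 1) := pow_le_pow_right₀ one_le_two (by omega)
      rw [div_lt_iff₀ hr₁] at hk
      have h3 : r₁ * 2 ^ (l₀ + k + 1) ≤ r₂ * 2 ^ (l₀ + 1) :=
        (mul_le_mul_of_nonneg_left h2 hr₁.le).trans (h1.1.trans h0.2)
      have h4 : r₁ * (2 : ℝ) ^ (l₀ + k + 1) = (2 ^ k * r₁) * 2 ^ (l₀ + 1) := by ring
      rw [h4] at h3
      exact absurd (le_of_mul_le_mul_right h3 (by positivity)) (not_le.2 hk)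
    rw [tsum_eq_sum hout]
    refine (Finset.sum_le_card_nsmul _ _ (ENNReal.ofReal B) fun l _ => ?_).trans_eq ?_
    · rw [← ofReal_norm]
      exact ENNReal.ofReal_le_ofReal (hBd _)
    · rw [Nat.card_Ico, nsmul_eq_mul]; congr 2; omega
  · push Not at hex
    simp [hex]

/-- The trilinear form as an absolutely convergent integral in frequency space. -/
lemma summable_and_form_eq {φ ψ : 𝓢(ℝ, ℝ)} (h : IsLittlewoodPaley φ ψ) {θ₁ θ₂ : ℝ}
    {μ : Measure ℝ} [IsProbabilityMeasure μ]
    (hT : Integrable (triple μ (θ₂ / (θ₂ - θ₁)) (θ₁ / (θ₂ - θ₁)))) :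
    Summable (fun l : ℕ => |formAt θ₁ θ₂ (conv ψ (l + 1) μ) μ|) ∧
      ((form φ ψ θ₁ θ₂ μ : ℝ) : ℂ) = ∫ ξ, triple μ (θ₂ / (θ₂ - θ₁)) (θ₁ / (θ₂ - θ₁)) ξ := by
  set T := triple μ (θ₂ / (θ₂ - θ₁)) (θ₁ / (θ₂ - θ₁)) with hTdef
  obtain ⟨C, hC, hCb⟩ := h.exists_tsum_le
  have hmul : ∀ (g : 𝓢(ℝ, ℝ)) (r : ℝ), Integrable fun ξ => schwartzHat g (ξ / r) * T ξ := by
    intro g r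
    obtain ⟨B, -, hB⟩ := exists_norm_schwartzHat_le g
    refine hT.bdd_mul (c := B) (Continuous.aestronglyMeasurable ?_)
      (Filter.Eventually.of_forall fun ξ => hB _)
    have := continuous_schwartzHat g
    fun_prop
  set f : ℕ → ℝ → ℂ := fun l ξ => schwartzHat ψ (ξ / 2 ^ (l + 1)) * T ξ with hf
  have hfi : ∀ l, Integrable (f l) := fun l => hmul ψ _
  have hlint : ∑' l, ∫⁻ ξ, ‖f l ξ‖ₑ ≠ ⊤ := by
    rw [← lintegral_tsum fun l => (hfi l).aestronglyMeasurable.enorm]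
    refine ne_top_of_le_ne_top (ENNReal.mul_ne_top hC hT.2.ne) ?_
    rw [← lintegral_const_mul' _ _ hC]
    refine lintegral_mono fun ξ => ?_
    simp only [hf, enorm_mul]
    rw [ENNReal.tsum_mul_right]
    exact mul_le_mul_left (hCb ξ) _
  have hsumn : Summable fun l => ∫ ξ, ‖f l ξ‖ := by
    have := ENNReal.summable_toReal hlint
    refine this.congr fun l => ?_
    rw [integral_norm_eq_lintegral_enorm (hfi l).aestronglyMeasurable]
  have hform : ∀ l, ((formAt θ₁ θ₂ (conv ψ (l + 1) μ) μ : ℝ) : ℂ) = ∫ ξ, f l ξ :=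
    fun l => formAt_conv_eq ψ (l + 1) θ₁ θ₂ μ
  have hsum : HasSum (fun l => ∫ ξ, f l ξ) (∫ ξ, ∑' l, f l ξ) :=
    hasSum_integral_of_summable_integral_norm hfi hsumn
  constructor
  · refine Summable.of_nonneg_of_le (fun l => abs_nonneg _) (fun l => ?_) hsumn
    rw [← Real.norm_eq_abs, ← Complex.norm_real, hform]
    exact norm_integral_le_integral_norm _
  · have hpt : ∀ ξ, ∑' l, f l ξ = T ξ - schwartzHat φ (ξ / 2 ^ 0) * T ξ := by
      intro ξ
      rw [((h.hasSum ξ).mul_right (T ξ)).tsum_eq, pow_zero, div_one]; ring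
    rw [form, Complex.ofReal_add, Complex.ofReal_tsum, formAt_conv_eq]
    simp_rw [hform]
    rw [hsum.tsum_eq]
    simp_rw [hpt]
    rw [integral_sub hT (hmul φ _)]
    ring

/-! ### Comparison with the mollified form -/

/-- Beyond R the multiplier difference is at most 2∫g and the tail bound applies; below R the
difference is at most δ and the integrand at most 1, on a set of length 2R. -/
lemma norm_integral_triple_sub_le {g : 𝓢(ℝ, ℝ)} (hg0 : ∀ x, 0 ≤ g x) {μ : Measure ℝ}
    [IsProbabilityMeasure μ] {a b R C r δ : ℝ} (hR : 0 ≤ R) (hC : 0 ≤ C) (hδ : 0 ≤ δ)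
    (htail : ∫⁻ ξ in {ξ : ℝ | R ≤ |ξ|}, ENNReal.ofReal ‖triple μ a b ξ‖ ≤ ENNReal.ofReal C)
    (hlow : ∀ ξ, |ξ| ≤ R → ‖((∫ x, g x : ℝ) : ℂ) - schwartzHat g (ξ / r)‖ ≤ δ) :
    ‖((∫ x, g x : ℝ) : ℂ) * (∫ ξ, triple μ a b ξ) - ∫ ξ, schwartzHat g (ξ / r) * triple μ a b ξ‖
      ≤ 2 * (∫ x, g x) * C + δ * (2 * R) := by
  have hT := integrable_triple htail
  have hI0 : 0 ≤ ∫ x, g x := integral_nonneg hg0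
  set I := ∫ x, g x with hI
  have hmul : Integrable fun ξ => schwartzHat g (ξ / r) * triple μ a b ξ := by
    refine hT.bdd_mul (c := I) (Continuous.aestronglyMeasurable ?_)
      (Filter.Eventually.of_forall fun ξ => norm_schwartzHat_le_integral g hg0 _)
    have := continuous_schwartzHat g
    fun_prop
  rw [← integral_const_mul, ← integral_sub (hT.const_mul _) hmul]
  refine (norm_integral_le_lintegral_norm _).trans ?_
  refine ENNReal.toReal_le_of_le_ofReal (by positivity) ?_
  rw [lintegral_eq_add_tail _ R, ENNReal.ofReal_add (by positivity) (by positivity)]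
  refine add_le_add ?_ ?_
  · calc _ ≤ ∫⁻ ξ in {ξ : ℝ | R ≤ |ξ|}, ENNReal.ofReal (2 * I) *
          ENNReal.ofReal ‖triple μ a b ξ‖ := by
          refine lintegral_mono fun ξ => ?_
          rw [← ENNReal.ofReal_mul (by positivity), ← sub_mul, norm_mul]
          refine ENNReal.ofReal_le_ofReal (mul_le_mul_of_nonneg_right ?_ (norm_nonneg _))
          refine (norm_sub_le _ _).trans ?_
          rw [Complex.norm_real, Real.norm_of_nonneg hI0]
          linarith [norm_schwartzHat_le_integral g hg0 (ξ / r)]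
      _ ≤ _ := by
          rw [lintegral_const_mul' _ _ ENNReal.ofReal_ne_top,
            ENNReal.ofReal_mul (p := 2 * I) (by positivity)]
          exact mul_le_mul_right htail _
  · refine (setLIntegral_mono' (g := fun _ => ENNReal.ofReal δ)
      (measurableSet_abs_ge R).compl fun ξ hξ => ?_).trans ?_
    · simp only [Set.mem_compl_iff, Set.mem_ofPred_eq, not_le] at hξ
      refine ENNReal.ofReal_le_ofReal ?_
      rw [← sub_mul, norm_mul]
      calc _ ≤ δ * 1 := mul_le_mul (hlow ξ hξ.le) (norm_triple_le_one μ a b ξ) (norm_nonneg _) hδ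
        _ = δ := mul_one δ
    · rw [setLIntegral_const, ENNReal.ofReal_mul hδ]
      refine mul_le_mul_right ((measure_mono (t := Set.Icc (-R) R) fun ξ hξ => ?_).trans_eq ?_) _
      · simp only [Set.mem_compl_iff, Set.mem_ofPred_eq, not_le] at hξ
        exact abs_le.1 hξ.le
      · rw [Real.volume_Icc]; congr 1; ring

lemma measure_neighbourhood_le_trilinear {g : 𝓢(ℝ, ℝ)} (hg0 : ∀ x, 0 ≤ g x) {C r : ℝ}
    (hg : ∀ x, |x| ≤ C → g x = 1) (hr : 0 < r) (a b : ℝ) (μ : Measure ℝ)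
    [IsProbabilityMeasure μ] :
    r * (μ.prod (μ.prod μ)).real {p : ℝ × ℝ × ℝ | |a * p.2.1 - b * p.1 - p.2.2| ≤ C * r⁻¹} ≤
      ∫ t, ∫ x, ∫ z, r * g (r * (a * x - b * t - z)) ∂μ ∂μ ∂μ := by
  obtain ⟨B, hB⟩ := schwartz_bounded g
  have hbd : ∀ y, |r * g y| ≤ r * B := fun y => by
    rw [abs_mul, abs_of_pos hr]; exact mul_le_mul_of_nonneg_left (hB y) hr.le
  have hgc := g.continuous
  have h1 : ∫ t, ∫ x, ∫ z, r * g (r * (a * x - b * t - z)) ∂μ ∂μ ∂μ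
      = ∫ p : ℝ × ℝ × ℝ, r * g (r * (a * p.2.1 - b * p.1 - p.2.2)) ∂(μ.prod (μ.prod μ)) :=
    integral_trilinear_eq_prod (G := fun y => r * g (r * y)) (by fun_prop) (fun y => hbd _) a b μ μ μ
  have hm : MeasurableSet {p : ℝ × ℝ × ℝ | |a * p.2.1 - b * p.1 - p.2.2| ≤ C * r⁻¹} :=
    (isClosed_le (by fun_prop) (by fun_prop)).measurableSet
  rw [h1, ← integral_indicator_one hm, ← integral_const_mul]
  refine integral_mono (((integrable_const (1 : ℝ)).indicator hm).const_mul r)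
    (integrable_of_bounded_continuous (by fun_prop) (fun p => hbd _)) fun p => ?_
  refine mul_le_mul_of_nonneg_left ?_ hr.le
  by_cases hp : p ∈ {p : ℝ × ℝ × ℝ | |a * p.2.1 - b * p.1 - p.2.2| ≤ C * r⁻¹}
  · rw [Set.indicator_of_mem hp, hg, Pi.one_apply]
    rw [abs_mul, abs_of_pos hr]
    calc r * |a * p.2.1 - b * p.1 - p.2.2| ≤ r * (C * r⁻¹) := mul_le_mul_of_nonneg_left hp hr.le
      _ = C := by field_simp
  · rw [Set.indicator_of_notMem hp]; exact hg0 _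

/-! ### Coefficients coming from 𝒬_M -/

/-- A nonzero integer numerator has absolute value at least 1, so nonzero fractions and differences
are bounded below by the reciprocals of their denominators, at most M and M². -/
lemma ratQ_bounds {M : ℕ} {θ₁ θ₂ : ℝ} (h₁ : θ₁ ∈ ratQ M) (h₂ : θ₂ ∈ ratQ M) (hz : θ₁ ≠ 0)
    (hne : θ₁ ≠ θ₂) : 1 ≤ (M : ℝ) ∧ |θ₁| ≤ M ∧ (M : ℝ)⁻¹ ≤ |θ₁| ∧
      ((M : ℝ) ^ 2)⁻¹ ≤ |θ₂ - θ₁| := by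
  obtain ⟨⟨N, hN1, hNM, k, rfl⟩, hI⟩ := h₁
  obtain ⟨⟨N', hN1', hNM', k', rfl⟩, hI'⟩ := h₂
  have hN0 : (0 : ℝ) < N := by exact_mod_cast hN1
  have hN0' : (0 : ℝ) < N' := by exact_mod_cast hN1'
  have hle : (N : ℝ) ≤ M := by exact_mod_cast hNM
  have hle' : (N' : ℝ) ≤ M := by exact_mod_cast hNM'
  refine ⟨by exact_mod_cast hN1.trans hNM, abs_le.2 ⟨hI.1, hI.2⟩, ?_, ?_⟩
  · rw [abs_div, Nat.abs_cast]
    have hk : k ≠ 0 := by rintro rfl; simp at hz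
    have : (1 : ℝ) ≤ |(k : ℝ)| := by exact_mod_cast Int.one_le_abs hk
    calc (M : ℝ)⁻¹ ≤ (N : ℝ)⁻¹ := inv_anti₀ hN0 hle
      _ = 1 / N := (one_div _).symm
      _ ≤ |(k : ℝ)| / N := by gcongr
  · have e : (k' : ℝ) / N' - k / N = ((k' * N - k * N' : ℤ) : ℝ) / (N * N') := by
      push_cast; field_simp
    have hk : (k' * N - k * N' : ℤ) ≠ 0 := by
      intro h0
      rw [h0, Int.cast_zero, zero_div, sub_eq_zero] at e
      exact hne e.symm
    have : (1 : ℝ) ≤ |((k' * N - k * N' : ℤ) : ℝ)| := by exact_mod_cast Int.one_le_abs hk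
    rw [e, abs_div, abs_of_pos (by positivity : (0 : ℝ) < N * N')]
    calc ((M : ℝ) ^ 2)⁻¹ ≤ ((N : ℝ) * N')⁻¹ := by
          refine inv_anti₀ (by positivity) ?_
          rw [sq]; gcongr
      _ = 1 / (N * N') := (one_div _).symm
      _ ≤ _ := by gcongr

/-- Quantitative bounds for the coefficients of the trilinear form. -/
lemma ratQ_coefficients {M : ℕ} {θ₁ θ₂ : ℝ} (h₁ : θ₁ ∈ ratQ M) (h₂ : θ₂ ∈ ratQ M)
    (hz₁ : θ₁ ≠ 0) (hz₂ : θ₂ ≠ 0) (hne : θ₁ ≠ θ₂) :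
    (2 * ((M : ℝ) + 1) ^ 3)⁻¹ ≤ |θ₁| ∧ |θ₁| ≤ 2 * ((M : ℝ) + 1) ^ 3 ∧
      (2 * ((M : ℝ) + 1) ^ 3)⁻¹ ≤ |θ₁ / (θ₂ - θ₁)| ∧
      |θ₁ / (θ₂ - θ₁)| ≤ 2 * ((M : ℝ) + 1) ^ 3 := by
  obtain ⟨hM, ha, hb, hd⟩ := ratQ_bounds h₁ h₂ hz₁ hne
  have ha₂ := (ratQ_bounds h₂ h₁ hz₂ hne.symm).2.1
  have hM0 : (0 : ℝ) < M := by linarith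
  have hcube : (M : ℝ) ^ 3 ≤ ((M : ℝ) + 1) ^ 3 := by gcongr; linarith
  have hd' : |θ₂ - θ₁| ≤ 2 * M := (abs_sub _ _).trans (by linarith)
  have hd0 : 0 < |θ₂ - θ₁| := lt_of_lt_of_le (by positivity) hd
  have h13 : (M : ℝ) ≤ M ^ 3 := le_self_pow₀ hM (by norm_num)
  have h23 : (M : ℝ) ^ 2 ≤ M ^ 3 := pow_le_pow_right₀ hM (by norm_num)
  refine ⟨le_trans (inv_anti₀ hM0 (by linarith)) hb, by linarith, ?_, ?_⟩
  · rw [abs_div, le_div_iff₀ hd0]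
    refine le_trans ?_ hb
    calc (2 * ((M : ℝ) + 1) ^ 3)⁻¹ * |θ₂ - θ₁| ≤ (2 * (M : ℝ) ^ 2)⁻¹ * (2 * M) := by
          gcongr; linarith
      _ = (M : ℝ)⁻¹ := by field_simp
  · rw [abs_div, div_le_iff₀ hd0]
    calc |θ₁| ≤ M := ha
      _ = M ^ 3 * ((M : ℝ) ^ 2)⁻¹ := by field_simp
      _ ≤ 2 * ((M : ℝ) + 1) ^ 3 * |θ₂ - θ₁| := by gcongr; linarith

end Roth

end

/-! ### Choice of parameters and conclusion -/

open MeasureTheory Roth in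
theorem proposition4p1 (M : ℕ) (A : ℝ) :
    -- the lower bound depends only on `M` and on the Frostman constant `A`
    ∃ c : ℝ, 0 < c ∧
      ∀ (c₀ B : ℝ) (ω : ℕ → ℝ), 0 < c₀ → Filter.Tendsto ω Filter.atTop (nhds 0) →
        ∃ ε₀ : ℝ, 0 < ε₀ ∧
          ∀ (s : ℝ) (μ : MeasureTheory.Measure ℝ) (θ₁ θ₂ : ℝ) (φ ψ : SchwartzMap ℝ ℝ),
            1 - ε₀ < s → s ≤ 1 → (1 - s) / 4 < c₀ →
            MeasureTheory.IsProbabilityMeasure μ → μ (Set.Icc 0 1)ᶜ = 0 →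
            Roth.IsFrostman μ s A →
            Roth.IsFourierUniform μ c₀ B ω →
            θ₁ ∈ Roth.ratQ M → θ₂ ∈ Roth.ratQ M → θ₁ ≠ 0 → θ₂ ≠ 0 → θ₁ ≠ θ₂ →
            Roth.IsLittlewoodPaley φ ψ →
            Summable (fun l : ℕ => |Roth.formAt θ₁ θ₂ (Roth.conv ψ (l + 1) μ) μ|) ∧
              c ≤ Roth.form φ ψ θ₁ θ₂ μ := by
  set Q : ℝ := 2 * ((M : ℝ) + 1) ^ 3 with hQdef
  have hQ : 1 ≤ Q := by
    have : (1 : ℝ) ≤ ((M : ℝ) + 1) ^ 3 := one_le_pow₀ (by linarith [(Nat.cast_nonneg M : (0 : ℝ) ≤ M)])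
    linarith
  set K : ℝ := 2 * (max A 0 + 1) with hK
  have hA0 : 0 ≤ max A 0 := le_max_right _ _
  obtain ⟨c, hc, hcount⟩ := exists_neighbourhood_ge hQ (K := K) (by positivity)
  -- The plateau of `g` has the radius 1 + 2Q of the neighbourhood counted by `hcount`.
  obtain ⟨g, hg0, -, hg1, -, hI⟩ := exists_bump (C := 1 + 2 * Q) (by linarith)
  set I := ∫ x, g x with hIdef
  refine ⟨c / (2 * I), by positivity, fun c₀ B ω hc₀ hω => ?_⟩
  have hκ : 0 < c₀ / 2 := by positivity
  obtain ⟨C, R₀, hC, hR₀, htail⟩ := exists_tail_le hQ A hκ B hω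
  have hdecay : Filter.Tendsto (fun R : ℝ => 2 * I * (C * R ^ (-(c₀ / 2)))) Filter.atTop (nhds 0) := by
    have := ((tendsto_rpow_neg_atTop hκ).const_mul C).const_mul (2 * I)
    simpa using this
  -- `R` makes the tail error less than c/4; below, the tolerance c/(8R) over length 2R costs
  -- another c/4.
  obtain ⟨R, hRsmall, hRR₀⟩ := ((hdecay.eventually (gt_mem_nhds (show 0 < c / 4 by positivity))).and
    (Filter.eventually_ge_atTop R₀)).exists
  have hR0 : 0 < R := by linarith
  have hcont : Continuous fun η => ‖(I : ℂ) - schwartzHat g η‖ := by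
    have := continuous_schwartzHat g
    fun_prop
  have hat0 : ‖(I : ℂ) - schwartzHat g 0‖ < c / (8 * R) := by
    rw [schwartzHat_zero, sub_self, norm_zero]; positivity
  obtain ⟨η, hη, hηb⟩ := Metric.eventually_nhds_iff.1
    (hcont.continuousAt.eventually (gt_mem_nhds hat0))
  set r : ℝ := max 2 (2 * R / η) with hr
  have hr2 : 2 ≤ r := le_max_left _ _
  have hr0 : 0 < r := by linarith
  have hlow : ∀ ξ, |ξ| ≤ R → ‖(I : ℂ) - schwartzHat g (ξ / r)‖ ≤ c / (8 * R) := by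
    intro ξ hξ
    refine (hηb ?_).le
    rw [Real.dist_eq, sub_zero, abs_div, abs_of_pos hr0, div_lt_iff₀ hr0]
    have h1 : 2 * R ≤ r * η := (div_le_iff₀ hη).1 (le_max_right _ _)
    linarith
  have hlogr : 0 < Real.log r := Real.log_pos (by linarith)
  have hlog2 : 0 < Real.log 2 := Real.log_pos one_lt_two
  -- The three terms ensure 1 - s ≤ κ for the tail, s > 0, and r^(1-s) ≤ 2, which makes μ look like
  -- a bounded density at scale 1/r.
  refine ⟨min (c₀ / 2) (min (1 / 2) (Real.log 2 / Real.log r)), by positivity, ?_⟩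
  intro s μ θ₁ θ₂ φ ψ hs hs1 _ hμ hsupp hF hU hθ₁ hθ₂ hz₁ hz₂ hne hLP
  have hsκ : 1 - c₀ / 2 ≤ s := by
    linarith [min_le_left (c₀ / 2) (min (1 / 2) (Real.log 2 / Real.log r))]
  have hs2 : 1 - min (1 / 2) (Real.log 2 / Real.log r) < s := by
    linarith [min_le_right (c₀ / 2) (min (1 / 2) (Real.log 2 / Real.log r))]
  have hs0 : 0 < s := by linarith [min_le_left (1 / 2) (Real.log 2 / Real.log r)]
  have hsr : 1 - s ≤ Real.log 2 / Real.log r := by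
    linarith [min_le_right (1 / 2) (Real.log 2 / Real.log r)]
  have hrs : r ^ (1 - s) ≤ 2 := by
    rw [Real.rpow_def_of_pos hr0]
    calc Real.exp (Real.log r * (1 - s)) ≤ Real.exp (Real.log 2) := by
          rw [Real.exp_le_exp]
          rw [le_div_iff₀ hlogr] at hsr
          linarith
      _ = 2 := Real.exp_log two_pos
  obtain ⟨b1, b2, b3, b4⟩ := ratQ_coefficients hθ₁ hθ₂ hz₁ hz₂ hne
  obtain ⟨-, d2, d3, d4⟩ := ratQ_coefficients hθ₂ hθ₁ hz₂ hz₁ hne.symm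
  have hsw : |θ₂ / (θ₁ - θ₂)| = |θ₂ / (θ₂ - θ₁)| := by
    rw [abs_div, abs_div, abs_sub_comm]
  rw [hsw] at d3 d4
  have hsub : θ₂ - θ₁ ≠ 0 := sub_ne_zero.2 hne.symm
  set a := θ₂ / (θ₂ - θ₁) with ha
  set b := θ₁ / (θ₂ - θ₁) with hb
  have hab : a - b = 1 := by rw [ha, hb]; field_simp
  have hθ : a * θ₁ = b * θ₂ := by rw [ha, hb]; ring
  have hU' : IsFourierUniform μ (2 * (c₀ / 2)) B ω := by rwa [mul_div_cancel₀ _ two_ne_zero]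
  have htail' := htail s μ a b hs0 hsκ hs1 hμ hF hU' d3 d4 b3 b4 R hRR₀
  have hT : Integrable (triple μ a b) := integrable_triple htail'
  obtain ⟨hsummable, hform⟩ := summable_and_form_eq hLP hT
  refine ⟨hsummable, ?_⟩
  have hwindow : ∀ x, μ (Set.Icc (x - r⁻¹) (x + r⁻¹)) ≤ ENNReal.ofReal (2 * r⁻¹ * K) := by
    intro x
    have hri : 0 < r⁻¹ := inv_pos.2 hr0
    have h1 := hF.real_le (a := x - r⁻¹) (b := x + r⁻¹) (by linarith)
    have e1 : x + r⁻¹ - (x - r⁻¹) = 2 * r⁻¹ := by ring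
    rw [e1] at h1
    rw [← ofReal_measureReal]
    refine ENNReal.ofReal_le_ofReal (h1.trans ?_)
    have h2 : (2 * r⁻¹) ^ s ≤ 2 * r⁻¹ * 2 := by
      rw [Real.mul_rpow zero_le_two hri.le]
      have h3 : (2 : ℝ) ^ s ≤ 2 := by
        calc (2 : ℝ) ^ s ≤ 2 ^ (1 : ℝ) := Real.rpow_le_rpow_of_exponent_le one_le_two hs1
          _ = 2 := Real.rpow_one 2
      have h4 : r⁻¹ ^ s = r⁻¹ * r ^ (1 - s) := by
        rw [Real.inv_rpow hr0.le, Real.rpow_sub hr0, Real.rpow_one]; field_simp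
      rw [h4, mul_assoc]
      exact mul_le_mul h3 (mul_le_mul_of_nonneg_left hrs hri.le) (by positivity) zero_le_two
    calc max A 0 * (2 * r⁻¹) ^ s ≤ (max A 0 + 1) * (2 * r⁻¹ * 2) :=
          mul_le_mul (by linarith) h2 (by positivity) (by positivity)
      _ = 2 * r⁻¹ * K := by rw [hK]; ring
  have hcnt := hcount θ₁ θ₂ a b r⁻¹ μ hμ hsupp b1 b2 d2 d4 b4 hab hθ (inv_pos.2 hr0)
    (inv_le_one_of_one_le₀ (by linarith)) hwindow
  have hcnt' := (ENNReal.ofReal_le_iff_le_toReal (measure_ne_top _ _)).1 hcnt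
  have hphys := measure_neighbourhood_le_trilinear hg0 hg1 hr0 a b μ
  have hJ : c ≤ ∫ t, ∫ x, ∫ z, r * g (r * (a * x - b * t - z)) ∂μ ∂μ ∂μ := by
    refine le_trans ?_ hphys
    calc c = r * (c * r⁻¹) := by field_simp
      _ ≤ _ := mul_le_mul_of_nonneg_left hcnt' hr0.le
  have herr := norm_integral_triple_sub_le hg0 hR0.le (by positivity) (by positivity) htail' hlow
  have htri := trilinear_eq g hr0 a b μ μ μ
  have htri' : ((∫ t, ∫ x, ∫ z, r * g (r * (a * x - b * t - z)) ∂μ ∂μ ∂μ : ℝ) : ℂ) =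
      ∫ ξ, schwartzHat g (ξ / r) * triple μ a b ξ := htri
  rw [← htri', ← hform, ← Complex.ofReal_mul, ← Complex.ofReal_sub, Complex.norm_real,
    Real.norm_eq_abs] at herr
  have e8 : c / (8 * R) * (2 * R) = c / 4 := by field_simp; norm_num
  rw [e8] at herr
  -- Thus I Λ ≥ c - c/4 - c/4 = c/2.
  have hfin := (abs_le.1 herr).1
  rw [div_le_iff₀ (by positivity)]
  linarith
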